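/- **Proposition 3.1.** Let $R>0$, let $D=\{x\in\mathbb R^3:|x|<R\}$ with exterior unit normal $\nu_x=\hat x=x/|x|$ on $\partial D$ and surface measure $ds$, let $k\in\mathbb C\setminus\{0\}$ and $G(x,y,k)=-\dfrac{e^{\mathrm i k|x-y|}}{4\pi|x-y|}$. The magnetic dipole operator is $$\mathcal M_D^k[\varphi](x)=\int_{\partial D}\nu_x\times\nabla_x\times\big(G(x,y,k)\varphi(y)\big)\,ds(y),\qquad x\in\partial D,$$ for $\varphi$ in the space $TH(\mathrm{div},\partial D)$ of tangential fields $\varphi\in L^2(\partial D)^3$ with weak surface divergence $\nabla_{\partial D}\cdot\varphi\in L^2(\partial D)$. Let $j_n$ and $h_n^{(1)}$ be the spherical Bessel function and the spherical Hankel function of the first kind, and put $$\lambda_{n,k,R}=\tfrac12-\mathrm i k^2R^2\,j_n'(kR)\,h_n^{(1)}(kR),\qquad \chi_{n,k,R}=-\mathrm i kR^2\,h_n^{(1)}(kR)\,j_n(kR)\qquad(n\ge 0),$$ and, for $n\ge1$, $$\pi_{1,n}=\frac{(n+1)\lambda_{n-1,k,R}+n\lambda_{n+1,k,R}}{2n+1},\quad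 \sigma_{1,n}=\frac{(n+1)\chi_{n-1,k,R}+n\chi_{n+1,k,R}}{2n+1},\quad \sigma_{3,n}=\frac{\chi_{n-1,k,R}-\chi_{n+1,k,R}}{2n+1}.$$ Let $n\ge1$, let $Y_n$ be a spherical harmonic of degree $n$ that is not identically zero (the restriction to the unit sphere $\mathbb S$ of a homogeneous harmonic polynomial of degree $n$ on $\mathbb R^3$ with complex coefficients), and let $\nabla_{\mathbb S}Y_n$ be its surface gradient on $\mathbb S$; regard $\nabla_{\mathbb S}Y_n$ and $\nabla_{\mathbb S}Y_n\times\nu$ as fields on $\partial D$ by evaluating them at $\hat x$. Then both fields are nonzero elements of $TH(\mathrm{div},\partial D)$ and are eigenfunctions of $\mathcal M_D^k$: at every $x\in\partial D$ the defining integrals converge absolutely, and $$\mathcal M_D^k[\nabla_{\mathbb S}Y_n\times\nu]=m_{1,n}^k\,\nabla_{\mathbb S}Y_n\times\nu,\qquad \mathcal M_D^k[\nabla_{\mathbb S}Y_n]=m_{2,n}^k\,\nabla_{\mathbb S}Y_n,$$ where $$m_{1,n}^k=\pi_{1,n}+\frac1R\big(\sigma_{1,n}-n(n+1)\sigma_{3,n}\big),\qquad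 m_{2,n}^k=\lambda_{n,k,R}+\frac{\chi_{n,k,R}}{R}.$$ -/

import Mathlib

open MeasureTheory Metric Set
open scoped ContDiff

namespace MaxwellBall

/-- Euclidean space `ℝ³`. -/
abbrev E3 := EuclideanSpace ℝ (Fin 3)

/-- Complex vectors, the values of the vector densities. -/
abbrev C3 := Fin 3 → ℂ

/-! ### Vector calculus -/

/-- The partial derivative `∂_i f (x)`. -/
noncomputable def pd (i : Fin 3) (f : E3 → ℂ) (x : E3) : ℂ :=
  fderiv ℝ f x (EuclideanSpace.single i 1)

/-- The gradient `∇ f (x)`. -/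
noncomputable def grad (f : E3 → ℂ) (x : E3) : C3 := fun i => pd i f x

/-- The curl `(∇ × F)(x)` of a vector field. -/
noncomputable def curl (F : E3 → C3) (x : E3) : C3 :=
  ![pd 1 (fun z => F z 2) x - pd 2 (fun z => F z 1) x,
    pd 2 (fun z => F z 0) x - pd 0 (fun z => F z 2) x,
    pd 0 (fun z => F z 1) x - pd 1 (fun z => F z 0) x]

/-! ### The sphere of radius `R`, boundary of the central ball of radius `R` -/

/-- The surface measure `ds` of `sphere 0 R` (as a measure on `ℝ³`): the image of the surface
measure of the unit sphere under `ξ ↦ R ξ`, multiplied by `R ^ 2`. -/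
noncomputable def surf (R : ℝ) : Measure E3 :=
  ENNReal.ofReal (R ^ 2) •
    (volume : Measure E3).toSphere.map (fun ξ : sphere (0 : E3) 1 => R • (ξ : E3))

/-- The point `x̂ = x / |x|` of the unit sphere. -/
noncomputable def unitPt (x : E3) : E3 := ‖x‖⁻¹ • x

/-- The exterior unit normal `ν_x = x / |x|` of a central ball, as a complex vector. -/
noncomputable def normal (x : E3) : C3 := fun i => ((unitPt x i : ℝ) : ℂ)

/-- The surface gradient `∇_𝕊 Y` on the unit sphere, evaluated at `x̂`: the gradient at `x̂` of the
extension of `Y` that is homogeneous of degree `0`. It depends only on the values of `Y` on the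
unit sphere. -/
noncomputable def sphereGrad (Y : E3 → ℂ) (x : E3) : C3 :=
  grad (fun z => Y (unitPt z)) (unitPt x)

/-- The field `∇_𝕊 Y × ν`, evaluated at `x̂`. -/
noncomputable def sphereCurl (Y : E3 → ℂ) (x : E3) : C3 :=
  crossProduct (sphereGrad Y x) (normal x)

/-- `Y` is, on the unit sphere, a spherical harmonic of degree `n`: the restriction of a
homogeneous harmonic polynomial of degree `n`. -/
def IsSphericalHarmonic (n : ℕ) (Y : E3 → ℂ) : Prop :=
  ∃ P : MvPolynomial (Fin 3) ℂ, P.IsHomogeneous n ∧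
    ∑ i : Fin 3, MvPolynomial.pderiv i (MvPolynomial.pderiv i P) = 0 ∧
    ∀ ξ ∈ sphere (0 : E3) 1, Y ξ = MvPolynomial.eval (fun i => ((ξ i : ℝ) : ℂ)) P

/-! ### The space `TH(div, ∂D)` -/

/-- `g` is the weak surface divergence of the tangential field `φ` on `sphere 0 R`. Since `φ` is
tangential, `φ · ∇ψ` is the product of `φ` with the surface gradient of `ψ`. -/
def HasSurfDiv (R : ℝ) (φ : E3 → C3) (g : E3 → ℂ) : Prop :=
  ∀ ψ : E3 → ℂ, ContDiff ℝ ∞ ψ →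
    ∫ y, g y * ψ y ∂(surf R) = - ∫ y, φ y ⬝ᵥ grad ψ y ∂(surf R)

/-- `φ ∈ TH(div, ∂D)`: square-integrable, tangential, with square-integrable surface
divergence. -/
def MemTHdiv (R : ℝ) (φ : E3 → C3) : Prop :=
  MemLp φ 2 (surf R) ∧ (∀ᵐ y ∂(surf R), normal y ⬝ᵥ φ y = 0) ∧
    ∃ g : E3 → ℂ, MemLp g 2 (surf R) ∧ HasSurfDiv R φ g

/-! ### The magnetic dipole operator -/

/-- The outgoing fundamental solution `G(x, y, k) = - e^{ik|x-y|} / (4π|x-y|)` of `Δ + k²`. -/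
noncomputable def green (k : ℂ) (x y : E3) : ℂ :=
  - Complex.exp (Complex.I * k * (‖x - y‖ : ℂ)) / (4 * (Real.pi : ℂ) * (‖x - y‖ : ℂ))

/-- The integrand `ν_x × (∇_x × (G(x, y, k) φ(y)))`. -/
noncomputable def dipoleIntegrand (k : ℂ) (φ : E3 → C3) (x y : E3) : C3 :=
  crossProduct (normal x) (curl (fun z => green k z y • φ y) x)

/-- The magnetic dipole operator
`M_D^k[φ](x) = ∫_{∂D} ν_x × (∇_x × (G(x, y, k) φ(y))) ds(y)`, `D` the central ball of
radius `R`. -/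
noncomputable def dipoleOp (R : ℝ) (k : ℂ) (φ : E3 → C3) (x : E3) : C3 :=
  ∫ y, dipoleIntegrand k φ x y ∂(surf R)

/-- `φ` is an eigenfunction of `M_D^k` for the eigenvalue `m`: it is a nonzero element of the
domain `TH(div, ∂D)` and, at every point of `∂D`, the integral that defines `M_D^k[φ]` converges
absolutely and equals `m φ`. -/
def IsDipoleEigenfunction (R : ℝ) (k m : ℂ) (φ : E3 → C3) : Prop :=
  MemTHdiv R φ ∧ ¬ (φ =ᵐ[surf R] 0) ∧
    ∀ x ∈ sphere (0 : E3) R,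
      Integrable (dipoleIntegrand k φ x) (surf R) ∧ dipoleOp R k φ x = m • φ x

/-! ### Spherical Bessel and Hankel functions and the eigenvalues -/

/-- Rayleigh's formula `(-z)ⁿ ((1/z) d/dz)ⁿ f (z)`. -/
noncomputable def rayleigh (f : ℂ → ℂ) (n : ℕ) (z : ℂ) : ℂ :=
  (-z) ^ n * ((fun (g : ℂ → ℂ) (w : ℂ) => deriv g w / w)^[n] f) z

/-- The spherical Bessel function `j_n` (used at `z ≠ 0` only), from `j_0(z) = sin z / z`. -/
noncomputable def sphJ (n : ℕ) (z : ℂ) : ℂ :=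
  rayleigh (fun w => Complex.sin w / w) n z

/-- The spherical Hankel function `h_n^{(1)}` of the first kind (used at `z ≠ 0` only), from
`h_0^{(1)}(z) = e^{iz} / (iz)`. -/
noncomputable def sphH (n : ℕ) (z : ℂ) : ℂ :=
  rayleigh (fun w => Complex.exp (Complex.I * w) / (Complex.I * w)) n z

/-- `λ_{n,k,R} = 1/2 - i k² R² j_n'(kR) h_n^{(1)}(kR)`. -/
noncomputable def lam (n : ℕ) (k : ℂ) (R : ℝ) : ℂ :=
  1 / 2 - Complex.I * k ^ 2 * (R : ℂ) ^ 2 * deriv (sphJ n) (k * R) * sphH n (k * R)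

/-- `χ_{n,k,R} = - i k R² h_n^{(1)}(kR) j_n(kR)`. -/
noncomputable def chi (n : ℕ) (k : ℂ) (R : ℝ) : ℂ :=
  - Complex.I * k * (R : ℂ) ^ 2 * sphH n (k * R) * sphJ n (k * R)

/-- `π_{1,n}`, for `n ≥ 1`. -/
noncomputable def pi1 (n : ℕ) (k : ℂ) (R : ℝ) : ℂ :=
  ((n + 1) * lam (n - 1) k R + n * lam (n + 1) k R) / (2 * n + 1)

/-- `σ_{1,n}`, for `n ≥ 1`. -/
noncomputable def sigma1 (n : ℕ) (k : ℂ) (R : ℝ) : ℂ :=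
  ((n + 1) * chi (n - 1) k R + n * chi (n + 1) k R) / (2 * n + 1)

/-- `σ_{3,n}`, for `n ≥ 1`. -/
noncomputable def sigma3 (n : ℕ) (k : ℂ) (R : ℝ) : ℂ :=
  (chi (n - 1) k R - chi (n + 1) k R) / (2 * n + 1)

/-- `m_{1,n}^k = π_{1,n} + (σ_{1,n} - n(n+1) σ_{3,n}) / R`. -/
noncomputable def m1 (n : ℕ) (k : ℂ) (R : ℝ) : ℂ :=
  pi1 n k R + 1 / (R : ℂ) * (sigma1 n k R - n * (n + 1) * sigma3 n k R)

/-- `m_{2,n}^k = λ_{n,k,R} + χ_{n,k,R} / R`. -/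
noncomputable def m2 (n : ℕ) (k : ℂ) (R : ℝ) : ℂ :=
  lam n k R + chi n k R / (R : ℂ)

end MaxwellBall

/-!
The magnetic dipole operator on a sphere acts diagonally on the two families of tangential fields
built from spherical harmonics because, after one integration by parts, it only involves the scalar
single layer operator and its normal derivative, which are diagonal on spherical harmonics.

After scaling to the unit sphere, put `s = |ξ - η|`, `z = k R`, `F(s) = e^{izs} / s`, and let
`L = η × ∇` be the angular derivatives. They integrate to zero over the sphere, since the surface
measure is rotation invariant (`integral_angDeriv`). Regularising `s` gives integration by parts
against the singular kernel `F` for polynomials that vanish at `ξ` (`integral_dker_mul_rot`).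

*The scalar operators.* For a harmonic polynomial `H` of degree `n + 1` and
`Q = ξ · ∇H / (n + 1)`, which has degree `n` and the same value at `ξ`, integration by parts gives a
relation between the integrals of `H` and `Q` against `F` and `e^{izs}` (`degree_recursion`). As
`∂F/∂z = i e^{izs}`, it is a first order differential equation in `z` that links consecutive
degrees, and the products `i z j_n(z) h_n(z)` satisfy the same equation. After multiplication by a
power of `z` everything is entire and vanishes at `z = 0`, so the equality propagates from degree
`0`, where it is Archimedes' theorem (`map_inner`), to all degrees (`sint_harm`). The normal
derivative is obtained by differentiating in `z` (`eint_eq`), because on the sphere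
`s ∂F/∂s = z ∂F/∂z - F`.

*The vector operator.* For a tangential polynomial field `φ` the tangential vector `ξ × M[φ](ξ)` is
a combination of single layer integrals of `L(ξ · φ)` and of normal derivative integrals of `ξ × φ`
(`dipole_of_polynomial`). The field `∇P × η` has harmonic components of degree `n`, and its
eigenvalue is `-(λ_n + χ_n / R)`. The components of the surface gradient split into degrees `n - 1`
and `n + 1` (`raise`, `gradField`), and its eigenvalue is
`-(π_1 + (σ_1 - n (n + 1) σ_3) / R)`. The Bessel recurrences and the Wronskian show that these are
`m_1` and `m_2`, that is `m_1 = -m_2` (`m1_eq_neg_m2`).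

Both fields have the form `W × η` with `W` polynomial, hence the surface divergence `∑ L_j W_j`
(`memTHdiv_cross`); neither vanishes identically, since `∑ L_j L_j P = -n (n + 1) P`.
-/

namespace MaxwellBall
open MvPolynomial (X C pderiv)
open scoped Pointwise

/-! ### Polynomials on `ℝ³` and their angular derivatives -/

/-- Complex polynomials in the three coordinates. -/
abbrev Poly := MvPolynomial (Fin 3) ℂ

/-- The coordinates of a point of `ℝ³`, as a complex vector. -/
def cplx (y : E3) : C3 := fun i => ((y i : ℝ) : ℂ)

/-- The function on `ℝ³` given by a complex polynomial. -/
noncomputable def ev (p : Poly) (y : E3) : ℂ := MvPolynomial.eval (cplx y) p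

/-- The angular derivative `(y × ∇)_j` of a polynomial; the indices are cyclic. -/
noncomputable def rot (j : Fin 3) (p : Poly) : Poly :=
  X (j + 1) * pderiv (j + 2) p - X (j + 2) * pderiv (j + 1) p

/-- The angular derivative `(y × ∇)_j u` of a function. -/
noncomputable def angDeriv (j : Fin 3) (u : E3 → ℂ) (y : E3) : ℂ :=
  (y (j + 1) : ℂ) * pd (j + 2) u y - (y (j + 2) : ℂ) * pd (j + 1) u y

@[simp] lemma ev_C (c : ℂ) (y : E3) : ev (C c) y = c := by simp [ev]
@[simp] lemma ev_X (i : Fin 3) (y : E3) : ev (X i) y = (y i : ℂ) := by simp [ev, cplx]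
@[simp] lemma ev_add (p q : Poly) (y : E3) : ev (p + q) y = ev p y + ev q y := by simp [ev]
@[simp] lemma ev_sub (p q : Poly) (y : E3) : ev (p - q) y = ev p y - ev q y := by simp [ev]
@[simp] lemma ev_neg (p : Poly) (y : E3) : ev (-p) y = -ev p y := by simp [ev]
@[simp] lemma ev_mul (p q : Poly) (y : E3) : ev (p * q) y = ev p y * ev q y := by simp [ev]
@[simp] lemma ev_pow (p : Poly) (m : ℕ) (y : E3) : ev (p ^ m) y = ev p y ^ m := by simp [ev]
@[simp] lemma ev_one (y : E3) : ev 1 y = 1 := by simp [ev]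
@[simp] lemma ev_zero (y : E3) : ev 0 y = 0 := by simp [ev]
@[simp] lemma ev_sum {ι : Type*} (s : Finset ι) (p : ι → Poly) (y : E3) :
    ev (∑ i ∈ s, p i) y = ∑ i ∈ s, ev (p i) y := by simp [ev]

lemma contDiff_coord (i : Fin 3) : ContDiff ℝ ∞ (fun y : E3 => ((y i : ℝ) : ℂ)) :=
  Complex.ofRealCLM.contDiff.comp (EuclideanSpace.proj (𝕜 := ℝ) i).contDiff

lemma contDiff_ev (p : Poly) : ContDiff ℝ ∞ (ev p) := by
  induction p using MvPolynomial.induction_on with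
  | C c => simpa [funext (ev_C c)] using contDiff_const
  | add p q hp hq => simpa [funext (ev_add p q)] using hp.add hq
  | mul_X p i hp =>
    simpa [funext (ev_mul p (X i)), funext (ev_X i)] using hp.mul (contDiff_coord i)

lemma continuous_ev (p : Poly) : Continuous (ev p) := (contDiff_ev p).continuous

lemma differentiable_ev (p : Poly) : Differentiable ℝ (ev p) :=
  (contDiff_ev p).differentiable (by simp)

lemma pd_add {i : Fin 3} {u v : E3 → ℂ} {y : E3} (hu : DifferentiableAt ℝ u y)
    (hv : DifferentiableAt ℝ v y) : pd i (fun z => u z + v z) y = pd i u y + pd i v y := by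
  simp [pd, fderiv_fun_add hu hv]

lemma pd_mul {i : Fin 3} {u v : E3 → ℂ} {y : E3} (hu : DifferentiableAt ℝ u y)
    (hv : DifferentiableAt ℝ v y) :
    pd i (fun z => u z * v z) y = pd i u y * v y + u y * pd i v y := by
  simp only [pd, fderiv_fun_mul hu hv]
  simp
  ring

lemma hasFDerivAt_coord (i : Fin 3) (y : E3) : HasFDerivAt (fun z : E3 => ((z i : ℝ) : ℂ))
    (Complex.ofRealCLM ∘L (EuclideanSpace.proj (𝕜 := ℝ) i)) y :=
  (Complex.ofRealCLM ∘L (EuclideanSpace.proj (𝕜 := ℝ) i)).hasFDerivAt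

lemma pd_coord (i j : Fin 3) (y : E3) :
    pd i (fun z : E3 => ((z j : ℝ) : ℂ)) y = if i = j then 1 else 0 := by
  simp only [pd, (hasFDerivAt_coord j y).fderiv]
  by_cases h : i = j
  · simp [h]
  · simp [h, Ne.symm h]

lemma pd_ev (i : Fin 3) (p : Poly) (y : E3) : pd i (ev p) y = ev (pderiv i p) y := by
  induction p using MvPolynomial.induction_on with
  | C c => simp [pd, funext (ev_C c)]
  | add p q hp hq =>
    rw [funext (ev_add p q), pd_add (differentiable_ev p y) (differentiable_ev q y), hp, hq]
    simp
  | mul_X p j hp =>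
    rw [show ev (p * X j) = fun z => ev p z * ((z j : ℝ) : ℂ) from
      funext fun z => by simp, pd_mul (differentiable_ev p y)
      (hasFDerivAt_coord j y).differentiableAt, hp, pd_coord]
    by_cases h : i = j
    · subst h; simp [MvPolynomial.pderiv_X]; ring
    · simp [MvPolynomial.pderiv_X, h, Ne.symm h]; ring

lemma angDeriv_ev (j : Fin 3) (p : Poly) (y : E3) : angDeriv j (ev p) y = ev (rot j p) y := by
  simp [angDeriv, rot, pd_ev]

lemma angDeriv_mul {j : Fin 3} {u v : E3 → ℂ} {y : E3} (hu : DifferentiableAt ℝ u y)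
    (hv : DifferentiableAt ℝ v y) :
    angDeriv j (fun z => u z * v z) y = angDeriv j u y * v y + u y * angDeriv j v y := by
  simp only [angDeriv, pd_mul hu hv]; ring

lemma continuous_pd {u : E3 → ℂ} (hu : ContDiff ℝ 1 u) (i : Fin 3) : Continuous (pd i u) :=
  (hu.continuous_fderiv (by simp)).clm_apply continuous_const

lemma continuous_angDeriv {u : E3 → ℂ} (hu : ContDiff ℝ 1 u) (j : Fin 3) :
    Continuous (angDeriv j u) := by
  have h := continuous_pd hu
  unfold angDeriv
  have hc (i : Fin 3) : Continuous (fun y : E3 => ((y i : ℝ) : ℂ)) := (contDiff_coord i).continuous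
  exact ((hc _).mul (h _)).sub ((hc _).mul (h _))

/-! ### Rotations and integrals of angular derivatives -/

/-- The unit sphere. -/
abbrev S2 := sphere (0 : E3) 1

/-- The surface measure of the unit sphere. -/
noncomputable abbrev sig : Measure S2 := (volume : Measure E3).toSphere

lemma integrable_sphere {f : E3 → ℂ} (hf : Continuous f) :
    Integrable (fun η : S2 => f η) sig := by
  obtain ⟨M, hM⟩ := (isCompact_sphere (0 : E3) 1).exists_bound_of_continuousOn hf.continuousOn
  exact Integrable.of_bound (hf.comp continuous_subtype_val).aestronglyMeasurable M
    (.of_forall fun η => hM η η.2)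

/-- A linear isometry of `ℝ³` preserves the surface measure of the unit sphere. -/
lemma integral_comp_isometry (A : E3 ≃ₗᵢ[ℝ] E3) (u : E3 → ℂ) :
    ∫ η : S2, u (A η) ∂sig = ∫ η : S2, u η ∂sig := by
  have h1 (η : S2) : A η ∈ sphere (0 : E3) 1 := by simp
  have h2 (η : S2) : A.symm η ∈ sphere (0 : E3) 1 := by simp
  have m1 : Measurable fun η : S2 => A η := A.continuous.measurable.comp measurable_subtype_coe
  have m2 : Measurable fun η : S2 => A.symm η :=
    A.symm.continuous.measurable.comp measurable_subtype_coe
  let e : S2 ≃ᵐ S2 :=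
    { toFun := fun η => ⟨A η, h1 η⟩
      invFun := fun η => ⟨A.symm η, h2 η⟩
      left_inv := fun η => by ext; simp
      right_inv := fun η => by ext; simp
      measurable_toFun := m1.subtype_mk
      measurable_invFun := m2.subtype_mk }
  have hmp : MeasurePreserving e sig sig := by
    refine ⟨e.measurable, ?_⟩
    ext s hs
    rw [Measure.map_apply e.measurable hs, Measure.toSphere_apply' _ (e.measurable hs),
      Measure.toSphere_apply' _ hs]
    congr 1
    have hA := A.measurePreserving.measure_preimage_emb A.toHomeomorph.measurableEmbedding
      (Ioo (0 : ℝ) 1 • (((↑) : S2 → E3) '' s))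
    rw [← hA]
    congr 1
    ext x
    simp only [mem_smul, mem_image, mem_preimage]
    constructor
    · rintro ⟨r, hr, _, ⟨η, hη, rfl⟩, rfl⟩
      exact ⟨r, hr, _, ⟨e η, hη, rfl⟩, (map_smul A r (η : E3)).symm⟩
    · rintro ⟨r, hr, _, ⟨η, hη, rfl⟩, h⟩
      replace h : r • (η : E3) = A x := h
      refine ⟨r, hr, _, ⟨e.symm η, by simpa using hη, rfl⟩, ?_⟩
      apply A.injective
      rw [← h]
      simp [e]
  exact hmp.integral_comp e.measurableEmbedding (fun η : S2 => u η)

/-- The rotation by the angle `θ` about the `j`-th coordinate axis. -/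
noncomputable def rotate (j : Fin 3) (θ : ℝ) (y : E3) : E3 :=
  y + ((Real.cos θ - 1) * y (j + 1) - Real.sin θ * y (j + 2)) • EuclideanSpace.single (j + 1) 1
    + (Real.sin θ * y (j + 1) + (Real.cos θ - 1) * y (j + 2)) • EuclideanSpace.single (j + 2) 1

lemma norm_rotate (j : Fin 3) (θ : ℝ) (y : E3) : ‖rotate j θ y‖ = ‖y‖ := by
  have h := Real.sin_sq_add_cos_sq θ
  rw [← sq_eq_sq₀ (norm_nonneg _) (norm_nonneg _), EuclideanSpace.norm_sq_eq,
    EuclideanSpace.norm_sq_eq]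
  simp only [Real.norm_eq_abs, sq_abs, Fin.sum_univ_three]
  fin_cases j <;> simp [rotate] <;> ring_nf <;> simp only [Real.sin_sq] <;> ring

/-- The rotation `rotate j θ` as a linear isometry. -/
noncomputable def rotateIso (j : Fin 3) (θ : ℝ) : E3 ≃ₗᵢ[ℝ] E3 :=
  LinearIsometry.toLinearIsometryEquiv
    { toFun := rotate j θ
      map_add' := fun x y => by simp only [rotate, PiLp.add_apply]; module
      map_smul' := fun c y => by
        simp only [rotate, PiLp.smul_apply, smul_eq_mul, RingHom.id_apply]; module
      norm_map' := norm_rotate j θ } rfl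

lemma hasDerivAt_rotate (j : Fin 3) (θ : ℝ) (y : E3) :
    HasDerivAt (fun t => rotate j t y)
      ((-(rotate j θ y (j + 2))) • EuclideanSpace.single (j + 1) 1
        + (rotate j θ y (j + 1)) • EuclideanSpace.single (j + 2) 1) θ := by
  have h1 := ((((Real.hasDerivAt_cos θ).sub_const 1).mul_const (y (j + 1))).sub
    ((Real.hasDerivAt_sin θ).mul_const (y (j + 2)))).smul_const
      (EuclideanSpace.single (j + 1) (1 : ℝ) : E3)
  have h2 := (((Real.hasDerivAt_sin θ).mul_const (y (j + 1))).add
    (((Real.hasDerivAt_cos θ).sub_const 1).mul_const (y (j + 2)))).smul_const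
      (EuclideanSpace.single (j + 2) (1 : ℝ) : E3)
  have e1 : rotate j θ y (j + 1) = Real.cos θ * y (j + 1) - Real.sin θ * y (j + 2) := by
    fin_cases j <;> simp [rotate] <;> ring
  have e2 : rotate j θ y (j + 2) = Real.sin θ * y (j + 1) + Real.cos θ * y (j + 2) := by
    fin_cases j <;> simp [rotate] <;> ring
  refine ((h1.const_add y).add h2).congr_deriv ?_
  rw [e1, e2]
  module

lemma hasDerivAt_comp_rotate {u : E3 → ℂ} (hu : ContDiff ℝ 1 u) (j : Fin 3) (θ : ℝ) (y : E3) :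
    HasDerivAt (fun t => u (rotate j t y)) (angDeriv j u (rotate j θ y)) θ := by
  have h := ((hu.differentiable (by simp) (rotate j θ y)).hasFDerivAt).comp_hasDerivAt θ
    (hasDerivAt_rotate j θ y)
  refine h.congr_deriv ?_
  simp [angDeriv, pd]
  ring

/-- Angular derivatives integrate to zero over the sphere: they are the derivatives along the
rotations, which preserve the surface measure. -/
lemma integral_angDeriv {u : E3 → ℂ} (hu : ContDiff ℝ 1 u) (j : Fin 3) :
    ∫ η : S2, angDeriv j u η ∂sig = 0 := by
  obtain ⟨M, hM⟩ := (isCompact_sphere (0 : E3) 1).exists_bound_of_continuousOn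
    (continuous_angDeriv hu j).continuousOn
  have hrot (θ : ℝ) (η : S2) : rotate j θ η ∈ sphere (0 : E3) 1 := by
    simp [norm_rotate]
  have hcont (θ : ℝ) : Continuous (rotate j θ) := (rotateIso j θ).continuous
  have key := (hasDerivAt_integral_of_dominated_loc_of_deriv_le (μ := sig)
    (F := fun θ (η : S2) => u (rotate j θ η))
    (F' := fun θ (η : S2) => angDeriv j u (rotate j θ η)) (x₀ := 0) (s := univ)
    (bound := fun _ => M) Filter.univ_mem
    (.of_forall fun θ => (integrable_sphere (hu.continuous.comp (hcont θ))).aestronglyMeasurable)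
    (integrable_sphere (hu.continuous.comp (hcont 0)))
    (integrable_sphere ((continuous_angDeriv hu j).comp (hcont 0))).aestronglyMeasurable
    (.of_forall fun η θ _ => hM _ (hrot θ η)) (integrable_const M)
    (.of_forall fun η θ _ => hasDerivAt_comp_rotate hu j θ η)).2
  have hconst : (fun θ => ∫ η : S2, u (rotate j θ η) ∂sig) = fun _ => ∫ η : S2, u η ∂sig :=
    funext fun θ => integral_comp_isometry (rotateIso j θ) u
  rw [hconst] at key
  have h0 (η : S2) : rotate j 0 (η : E3) = η := by simp [rotate]
  simpa only [h0] using key.unique (hasDerivAt_const _ _)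

lemma integral_rot (j : Fin 3) (p : Poly) : ∫ η : S2, ev (rot j p) η ∂sig = 0 := by
  simpa only [angDeriv_ev] using
    integral_angDeriv ((contDiff_ev p).of_le (by simp)) j

/-! ### The distribution of `ξ · η` on the unit sphere -/

lemma rot_mul (j : Fin 3) (p q : Poly) : rot j (p * q) = rot j p * q + p * rot j q := by
  simp only [rot, Derivation.leibniz, smul_eq_mul]; ring

lemma rot_add (j : Fin 3) (p q : Poly) : rot j (p + q) = rot j p + rot j q := by
  simp only [rot, map_add]; ring

lemma rot_sub (j : Fin 3) (p q : Poly) : rot j (p - q) = rot j p - rot j q := by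
  simp only [rot, map_sub]; ring

lemma rot_C_mul (j : Fin 3) (c : ℂ) (p : Poly) : rot j (C c * p) = C c * rot j p := by
  rw [rot_mul]; simp [rot]

lemma rot_pow (j : Fin 3) (p : Poly) (m : ℕ) :
    rot j (p ^ m) = (m : Poly) * p ^ (m - 1) * rot j p := by
  simp only [rot, MvPolynomial.pderiv_pow]; ring

/-- The linear form `η ↦ ξ · η`. -/
noncomputable def dotP (ξ : E3) : Poly := ∑ i, C (ξ i : ℂ) * X i

lemma ev_dotP (ξ η : E3) : ev (dotP ξ) η = ξ 0 * η 0 + ξ 1 * η 1 + ξ 2 * η 2 := by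
  simp [dotP, Fin.sum_univ_three]

lemma ev_dotP_eq_inner (ξ η : E3) : ev (dotP ξ) η = ((inner ℝ ξ η : ℝ) : ℂ) := by
  simp only [ev_dotP, PiLp.inner_apply, Fin.sum_univ_three]
  simp
  ring

lemma pderiv_dotP (ξ : E3) (i : Fin 3) : pderiv i (dotP ξ) = C (ξ i : ℂ) := by
  fin_cases i <;> simp [dotP, Fin.sum_univ_three, MvPolynomial.pderiv_X]

lemma ev_rot_dotP (j : Fin 3) (ξ η : E3) :
    ev (rot j (dotP ξ)) η = η (j + 1) * ξ (j + 2) - η (j + 2) * ξ (j + 1) := by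
  simp [rot, pderiv_dotP]

lemma sq_sum_coord {ξ : E3} (h : ξ ∈ sphere (0 : E3) 1) :
    (ξ 0 : ℂ) ^ 2 + (ξ 1 : ℂ) ^ 2 + (ξ 2 : ℂ) ^ 2 = 1 := by
  have h1 : ‖ξ‖ ^ 2 = 1 := by simp [mem_sphere_zero_iff_norm.1 h]
  rw [EuclideanSpace.norm_sq_eq] at h1
  simp only [Real.norm_eq_abs, sq_abs, Fin.sum_univ_three] at h1
  exact_mod_cast h1

lemma sum_rot_dotP_sq {ξ η : E3} (hξ : ξ ∈ sphere (0 : E3) 1) (hη : η ∈ sphere (0 : E3) 1) :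
    ∑ j, ev (rot j (dotP ξ)) η ^ 2 = 1 - ev (dotP ξ) η ^ 2 := by
  have h1 := sq_sum_coord hξ
  have h2 := sq_sum_coord hη
  simp only [Fin.sum_univ_three, ev_rot_dotP, ev_dotP]
  simp only [Fin.isValue, Fin.reduceAdd]
  linear_combination (η 0 ^ 2 + η 1 ^ 2 + η 2 ^ 2 : ℂ) * h1 + h2

lemma sum_rot_rot_dotP (ξ η : E3) : ∑ j, ev (rot j (rot j (dotP ξ))) η = -2 * ev (dotP ξ) η := by
  simp [rot, pderiv_dotP, Fin.sum_univ_three, MvPolynomial.pderiv_X, ev_dotP]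
  ring

/-- The integral of `∑ L_j (t ^ m L_j t)`, with `t = ξ · η`, vanishes. -/
lemma moment_recursion {ξ : E3} (hξ : ξ ∈ sphere (0 : E3) 1) (m : ℕ) :
    (m + 2) * ∫ η : S2, ev (dotP ξ) η ^ (m + 1) ∂sig
      = m * ∫ η : S2, ev (dotP ξ) η ^ (m - 1) ∂sig := by
  have h0 : ∫ η : S2, ∑ j, ev (rot j (dotP ξ ^ m * rot j (dotP ξ))) η ∂sig = 0 := by
    rw [integral_finsetSum _ fun j _ => integrable_sphere (continuous_ev _)]
    simp [integral_rot]
  have h1 (η : S2) : ∑ j, ev (rot j (dotP ξ ^ m * rot j (dotP ξ))) η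
      = m * ev (dotP ξ) η ^ (m - 1) - (m + 2) * ev (dotP ξ) η ^ (m + 1) := by
    have e1 := sum_rot_dotP_sq hξ η.2
    have e2 := sum_rot_rot_dotP ξ η
    have e3 : (m : ℂ) * (ev (dotP ξ) η ^ (m - 1) * ev (dotP ξ) η ^ 2)
        = m * ev (dotP ξ) η ^ (m + 1) := by
      rcases m with _ | m
      · simp
      · rw [← pow_add]; rfl
    simp only [Fin.sum_univ_three] at e1 e2 ⊢
    simp only [rot_mul, rot_pow, ev_add, ev_mul, ev_pow]
    have e4 : ev (m : Poly) (η : E3) = m := by simp [ev]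
    rw [e4]
    linear_combination (m * ev (dotP ξ) η ^ (m - 1)) * e1 + ev (dotP ξ) η ^ m * e2 - e3
  simp only [h1] at h0
  rw [integral_sub, integral_const_mul, integral_const_mul] at h0
  · linear_combination -h0
  · exact (integrable_sphere ((continuous_ev (dotP ξ)).pow _)).const_mul _
  · exact (integrable_sphere ((continuous_ev (dotP ξ)).pow _)).const_mul _

lemma sig_univ : sig.real univ = 4 * Real.pi := by
  rw [Measure.toSphere_real_apply_univ]
  have : (volume (ball (0 : E3) 1)).toReal = Real.pi * 4 / 3 := by
    rw [EuclideanSpace.volume_ball_fin_three]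
    simp; positivity
  rw [Measure.real, this]
  simp
  ring

lemma integral_inner_pow {ξ : E3} (hξ : ξ ∈ sphere (0 : E3) 1) (m : ℕ) :
    ∫ η : S2, (inner ℝ ξ (η : E3)) ^ m ∂sig = 2 * Real.pi * ∫ t in (-1 : ℝ)..1, t ^ m := by
  have hcast (m : ℕ) : ∫ η : S2, (((inner ℝ ξ (η : E3)) ^ m : ℝ) : ℂ) ∂sig
      = ((∫ η : S2, (inner ℝ ξ (η : E3)) ^ m ∂sig : ℝ) : ℂ) := integral_complex_ofReal
  induction m using Nat.twoStepInduction with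
  | zero =>
    have h := sig_univ
    simp only [pow_zero, integral_const, smul_eq_mul, mul_one, h,
      intervalIntegral.integral_const]
    ring
  | one =>
    have h := moment_recursion hξ 0
    simp only [ev_dotP_eq_inner, ← Complex.ofReal_pow] at h
    rw [hcast] at h
    norm_num at h ⊢
    exact h
  | more m h1 _ =>
    have h := moment_recursion hξ (m + 1)
    simp only [ev_dotP_eq_inner, ← Complex.ofReal_pow] at h
    rw [hcast, hcast] at h
    have h' : ((m : ℝ) + 1 + 2) * ∫ η : S2, (inner ℝ ξ (η : E3)) ^ (m + 2) ∂sig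
      = (m + 1) * ∫ η : S2, (inner ℝ ξ (η : E3)) ^ m ∂sig := by
      have h2 := h
      simp only [Nat.add_sub_cancel] at h2
      exact_mod_cast h2
    rw [h1, integral_pow] at h'
    rw [integral_pow]
    have p1 : (m : ℝ) + 1 ≠ 0 := by positivity
    have p3 : (m : ℝ) + 1 + 2 ≠ 0 := by positivity
    apply mul_left_cancel₀ p3
    rw [h']
    push_cast
    field_simp
    ring

lemma measurable_inner_sphere (ξ : E3) : Measurable fun η : S2 => inner ℝ ξ (η : E3) :=
  (by fun_prop : Continuous fun η : S2 => inner ℝ ξ (η : E3)).measurable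

lemma inner_mem_Icc {ξ η : E3} (hξ : ξ ∈ sphere (0 : E3) 1) (hη : η ∈ sphere (0 : E3) 1) :
    inner ℝ ξ η ∈ Icc (-1 : ℝ) 1 := by
  have h := abs_real_inner_le_norm ξ η
  rw [mem_sphere_zero_iff_norm.1 hξ, mem_sphere_zero_iff_norm.1 hη] at h
  exact abs_le.1 (by simpa using h)

/-- Archimedes' theorem: on the unit sphere, `ξ · η` is uniformly distributed on `[-1, 1]`. -/
lemma map_inner {ξ : E3} (hξ : ξ ∈ sphere (0 : E3) 1) :
    sig.map (fun η : S2 => inner ℝ ξ (η : E3))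
      = ENNReal.ofReal (2 * Real.pi) • volume.restrict (Icc (-1 : ℝ) 1) := by
  have hpi : (0 : ℝ) ≤ 2 * Real.pi := by positivity
  have hfin : IsFiniteMeasure (ENNReal.ofReal (2 * Real.pi) • volume.restrict (Icc (-1 : ℝ) 1)) :=
    Measure.smul_finite _ ENNReal.ofReal_ne_top
  have hm := measurable_inner_sphere ξ
  have hpoly (p : Polynomial ℝ) : ∫ η : S2, p.eval (inner ℝ ξ (η : E3)) ∂sig
      = 2 * Real.pi * ∫ t in (-1 : ℝ)..1, p.eval t := by
    have hint (p : Polynomial ℝ) : Integrable (fun η : S2 => p.eval (inner ℝ ξ (η : E3))) sig := by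
      have hc : Continuous fun η : E3 => p.eval (inner ℝ ξ η) :=
        p.continuous.comp (by fun_prop)
      have := (integrable_sphere (Complex.continuous_ofReal.comp hc)).re
      simpa using this
    induction p using Polynomial.induction_on' with
    | add p q hp hq =>
      simp only [Polynomial.eval_add]
      rw [integral_add (hint p) (hint q), hp, hq, intervalIntegral.integral_add
        (p.continuous.intervalIntegrable _ _) (q.continuous.intervalIntegrable _ _)]
      ring
    | monomial m a =>
      simp only [Polynomial.eval_monomial]
      rw [integral_const_mul, integral_inner_pow hξ, intervalIntegral.integral_const_mul]
      ring
  apply ext_of_forall_integral_eq_of_IsFiniteMeasure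
  intro f
  rw [integral_map hm.aemeasurable f.continuous.aestronglyMeasurable, integral_smul_measure,
    ENNReal.toReal_ofReal hpi, smul_eq_mul, integral_Icc_eq_integral_Ioc,
    ← intervalIntegral.integral_of_le (by norm_num)]
  apply eq_of_abs_sub_le_all
  intro ε hε
  obtain ⟨p, hp⟩ := exists_polynomial_near_of_continuousOn (-1) 1 f f.continuous.continuousOn
    (ε / (8 * Real.pi)) (by positivity)
  have i1 : Integrable (fun η : S2 => f (inner ℝ ξ (η : E3))) sig :=
    Integrable.of_bound (f.continuous.comp (by fun_prop)).aestronglyMeasurable ‖f‖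
      (.of_forall fun η => f.norm_coe_le_norm _)
  have i2 : Integrable (fun η : S2 => p.eval (inner ℝ ξ (η : E3))) sig := by
    have hc : Continuous fun η : E3 => p.eval (inner ℝ ξ η) := p.continuous.comp (by fun_prop)
    simpa using (integrable_sphere (Complex.continuous_ofReal.comp hc)).re
  have b1 : |(∫ η : S2, f (inner ℝ ξ (η : E3)) ∂sig)
      - ∫ η : S2, p.eval (inner ℝ ξ (η : E3)) ∂sig| ≤ ε / 2 := by
    rw [← integral_sub i1 i2, ← Real.norm_eq_abs]
    refine (norm_integral_le_of_norm_le_const (C := ε / (8 * Real.pi))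
      (.of_forall fun η => ?_)).trans ?_
    · rw [Real.norm_eq_abs, abs_sub_comm]
      exact (hp _ (inner_mem_Icc hξ η.2)).le
    · rw [sig_univ]; field_simp; norm_num
  have b2 : |(∫ t in (-1 : ℝ)..1, p.eval t) - ∫ t in (-1 : ℝ)..1, f t|
      ≤ ε / (4 * Real.pi) := by
    rw [← intervalIntegral.integral_sub (p.continuous.intervalIntegrable _ _)
      (f.continuous.intervalIntegrable _ _), ← Real.norm_eq_abs]
    refine (intervalIntegral.norm_integral_le_of_norm_le_const (C := ε / (8 * Real.pi))
      fun t ht => ?_).trans ?_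
    · rw [uIoc_of_le (by norm_num)] at ht
      exact (hp t ⟨ht.1.le, ht.2⟩).le
    · rw [abs_of_nonneg (by norm_num)]; field_simp; norm_num
  rw [hpoly p] at b1
  have b3 : |2 * Real.pi * (∫ t in (-1 : ℝ)..1, p.eval t)
      - 2 * Real.pi * ∫ t in (-1 : ℝ)..1, f t| ≤ ε / 2 := by
    rw [← mul_sub, abs_mul, abs_of_nonneg hpi]
    calc _ ≤ 2 * Real.pi * (ε / (4 * Real.pi)) := by gcongr
      _ = ε / 2 := by field_simp; norm_num
  calc _ ≤ _ := abs_sub_le _ (2 * Real.pi * (∫ t in (-1 : ℝ)..1, p.eval t)) _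
    _ ≤ ε := by linarith

/-! ### The weakly singular kernels -/

lemma dist_sq {ξ η : E3} (hξ : ξ ∈ sphere (0 : E3) 1) (hη : η ∈ sphere (0 : E3) 1) :
    ‖ξ - η‖ ^ 2 = 2 - 2 * inner ℝ ξ η := by
  rw [norm_sub_sq_real, mem_sphere_zero_iff_norm.1 hξ, mem_sphere_zero_iff_norm.1 hη]
  ring

lemma dist_eq_sqrt {ξ η : E3} (hξ : ξ ∈ sphere (0 : E3) 1) (hη : η ∈ sphere (0 : E3) 1) :
    ‖ξ - η‖ = √(2 - 2 * inner ℝ ξ η) := by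
  rw [← dist_sq hξ hη, Real.sqrt_sq (norm_nonneg _)]

lemma ae_ne {ξ : E3} (hξ : ξ ∈ sphere (0 : E3) 1) : ∀ᵐ η : S2 ∂sig, ξ ≠ η := by
  have h : ∀ᵐ t ∂(sig.map (fun η : S2 => inner ℝ ξ (η : E3))), t ≠ 1 := by
    rw [map_inner hξ]
    refine Measure.ae_smul_measure ?_ _
    exact ae_restrict_of_ae (Measure.ae_ne volume 1)
  filter_upwards [ae_of_ae_map (measurable_inner_sphere ξ).aemeasurable h] with η hη h'
  apply hη
  rw [← h', real_inner_self_eq_norm_sq, mem_sphere_zero_iff_norm.1 hξ]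
  norm_num

lemma hasDerivAt_sqrt_aux {t : ℝ} (ht : t < 1) :
    HasDerivAt (fun t : ℝ => √(2 - 2 * t)) (-(√(2 - 2 * t))⁻¹) t := by
  have h1 : HasDerivAt (fun t : ℝ => 2 - 2 * t) (-2) t := by
    simpa using ((hasDerivAt_id t).const_mul 2).const_sub 2
  convert h1.sqrt (by linarith : 2 - 2 * t ≠ 0 ) using 1
  field_simp

lemma intervalIntegrable_inv_sqrt :
    IntervalIntegrable (fun t : ℝ => (√(2 - 2 * t))⁻¹) volume (-1) 1 := by
  apply intervalIntegral.intervalIntegrable_deriv_of_nonneg (g := fun t : ℝ => -√(2 - 2 * t))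
  · fun_prop
  · intro t ht
    have : t < 1 := by simpa using ht.2
    exact ((hasDerivAt_sqrt_aux this).neg).congr_deriv (neg_neg _)
  · intro t _
    positivity

/-- The weak singularity `1 / |ξ - η|` is integrable over the sphere. -/
lemma integrable_inv_dist {ξ : E3} (hξ : ξ ∈ sphere (0 : E3) 1) :
    Integrable (fun η : S2 => ‖ξ - η‖⁻¹) sig := by
  have h : Integrable (fun t : ℝ => (√(2 - 2 * t))⁻¹)
      (sig.map (fun η : S2 => inner ℝ ξ (η : E3))) := by
    rw [map_inner hξ]
    refine Integrable.smul_measure ?_ ENNReal.ofReal_ne_top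
    have := (intervalIntegrable_iff_integrableOn_Icc_of_le (by norm_num)).1
      intervalIntegrable_inv_sqrt
    exact this
  have h2 := h.comp_measurable (measurable_inner_sphere ξ)
  refine h2.congr (.of_forall fun η => ?_)
  simp [dist_eq_sqrt hξ η.2]

/-- The kernel `e^{izs} / s`. -/
noncomputable def sker (z : ℂ) (s : ℝ) : ℂ := Complex.exp (Complex.I * z * s) / s

lemma norm_exp_le (z : ℂ) {s : ℝ} (h0 : 0 ≤ s) (h3 : s ≤ 3) :
    ‖Complex.exp (Complex.I * z * s)‖ ≤ Real.exp (3 * ‖z‖) := by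
  rw [Complex.norm_exp]
  apply Real.exp_le_exp.2
  refine (Complex.re_le_norm _).trans ?_
  simp only [norm_mul, Complex.norm_I, one_mul, Complex.norm_real, Real.norm_eq_abs,
    abs_of_nonneg h0]
  nlinarith [norm_nonneg z]

lemma dist_le_two {ξ η : E3} (hξ : ξ ∈ sphere (0 : E3) 1) (hη : η ∈ sphere (0 : E3) 1) :
    ‖ξ - η‖ ≤ 2 := by
  have := norm_sub_le ξ η
  rw [mem_sphere_zero_iff_norm.1 hξ, mem_sphere_zero_iff_norm.1 hη] at this
  linarith

lemma measurable_dist (ξ : E3) : Measurable fun η : S2 => ‖ξ - η‖ :=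
  (by fun_prop : Continuous fun η : S2 => ‖ξ - η‖).measurable

lemma measurable_sker (z : ℂ) : Measurable (sker z) := by
  unfold sker; fun_prop

/-- A measurable function with a weak singularity at `ξ` is integrable. -/
lemma integrable_of_le_inv_dist {ξ : E3} (hξ : ξ ∈ sphere (0 : E3) 1) {f : S2 → ℂ}
    (hf : AEStronglyMeasurable f sig) (K : ℝ) (h : ∀ η : S2, ξ ≠ η → ‖f η‖ ≤ K * ‖ξ - η‖⁻¹) :
    Integrable f sig := by
  refine ((integrable_inv_dist hξ).const_mul K).mono' hf ?_
  filter_upwards [ae_ne hξ] with η hη using h η hη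

lemma integrable_sker_mul {ξ : E3} (hξ : ξ ∈ sphere (0 : E3) 1) (z : ℂ) {f : E3 → ℂ}
    (hf : Continuous f) : Integrable (fun η : S2 => sker z ‖ξ - η‖ * f η) sig := by
  obtain ⟨M, hM⟩ := (isCompact_sphere (0 : E3) 1).exists_bound_of_continuousOn hf.continuousOn
  refine integrable_of_le_inv_dist hξ ?_ (Real.exp (3 * ‖z‖) * M) fun η hη => ?_
  · exact (((measurable_sker z).comp (measurable_dist ξ)).mul
      (hf.measurable.comp measurable_subtype_coe)).aestronglyMeasurable
  · have h1 := norm_exp_le z (norm_nonneg (ξ - η)) ((dist_le_two hξ η.2).trans (by norm_num))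
    rw [sker, norm_mul, norm_div, Complex.norm_real, norm_norm, div_eq_mul_inv]
    calc _ ≤ (Real.exp (3 * ‖z‖) * ‖ξ - η‖⁻¹) * M := by
          gcongr
          exact hM η η.2
      _ = _ := by ring

/-- The zonal integral of `e^{izs} / s`. -/
lemma integral_sker {ξ : E3} (hξ : ξ ∈ sphere (0 : E3) 1) (z : ℂ) :
    z * ∫ η : S2, sker z ‖ξ - η‖ ∂sig
      = 4 * Real.pi * (Complex.sin z * Complex.exp (Complex.I * z)) := by
  have h1 : ∫ η : S2, sker z ‖ξ - η‖ ∂sig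
      = 2 * Real.pi * ∫ t in (-1 : ℝ)..1, sker z √(2 - 2 * t) := by
    have : ∫ η : S2, sker z ‖ξ - η‖ ∂sig
        = ∫ t, sker z √(2 - 2 * t) ∂(sig.map (fun η : S2 => inner ℝ ξ (η : E3))) := by
      rw [integral_map (measurable_inner_sphere ξ).aemeasurable]
      · exact integral_congr_ae (.of_forall fun η => by simp [dist_eq_sqrt hξ η.2])
      · exact ((measurable_sker z).comp (by fun_prop)).aestronglyMeasurable
    rw [this, map_inner hξ, integral_smul_measure, ENNReal.toReal_ofReal (by positivity),
      integral_Icc_eq_integral_Ioc, ← intervalIntegral.integral_of_le (by norm_num)]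
    simp
  -- an antiderivative of `z e^{izs} / s` in `t = 1 - s ^ 2 / 2` is `i e^{izs}`
  have h2 : ∫ t in (-1 : ℝ)..1, z * sker z √(2 - 2 * t)
      = Complex.I * Complex.exp (Complex.I * z * (√(2 - 2 * 1) : ℝ))
        - Complex.I * Complex.exp (Complex.I * z * (√(2 - 2 * (-1)) : ℝ)) := by
    apply intervalIntegral.integral_eq_sub_of_hasDerivAt_of_le
      (f := fun t : ℝ => Complex.I * Complex.exp (Complex.I * z * (√(2 - 2 * t) : ℝ))) (by norm_num)
    · fun_prop
    · intro t ht
      have hd := ((((hasDerivAt_sqrt_aux ht.2).ofReal_comp).const_mul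
        (Complex.I * z)).cexp).const_mul Complex.I
      refine hd.congr_deriv ?_
      rw [sker]
      push_cast
      linear_combination (-z * Complex.exp (Complex.I * z * (√(2 - 2 * t) : ℝ))
        / (√(2 - 2 * t) : ℝ)) * Complex.I_sq
    · refine IntervalIntegrable.const_mul ?_ z
      refine (intervalIntegrable_inv_sqrt.const_mul (Real.exp (3 * ‖z‖))).mono_fun ?_ ?_
      · exact ((measurable_sker z).comp (by fun_prop)).aestronglyMeasurable
      · refine (ae_restrict_iff' measurableSet_uIoc).2 (.of_forall fun t ht => ?_)
        rw [uIoc_of_le (by norm_num)] at ht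
        have : √(2 - 2 * t) ≤ 3 := by
          rw [Real.sqrt_le_left (by norm_num)]; linarith [ht.1]
        have h1 := norm_exp_le z (Real.sqrt_nonneg (2 - 2 * t)) this
        simp only [sker, Complex.norm_real, norm_mul, norm_inv, div_eq_mul_inv]
        gcongr
        exact h1.trans (le_abs_self _)
  rw [h1]
  rw [intervalIntegral.integral_const_mul] at h2
  have h4 : √(2 - 2 * (-1)) = 2 := by
    rw [show (2 : ℝ) - 2 * (-1) = 2 ^ 2 by norm_num, Real.sqrt_sq (by norm_num)]
  have h5 : Complex.exp (Complex.I * z * 2) = Complex.exp (Complex.I * z) ^ 2 := by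
    rw [← Complex.exp_nat_mul]; congr 1; push_cast; ring
  have h6 : Complex.exp (-(Complex.I * z)) * Complex.exp (Complex.I * z) = 1 := by
    rw [← Complex.exp_add]; simp
  rw [h4] at h2
  simp only [mul_one, sub_self, Real.sqrt_zero, Complex.ofReal_zero, mul_zero, Complex.exp_zero,
    Complex.ofReal_ofNat, h5] at h2
  rw [Complex.sin, show -z * Complex.I = -(Complex.I * z) by ring, mul_comm z Complex.I]
  linear_combination 2 * Real.pi * h2 - 2 * Real.pi * Complex.I * h6

/-! ### Integration by parts against the singular kernel -/

/-- The kernel `-F'(s) / s` for `F(s) = e^{izs} / s`. -/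
noncomputable def dker (z : ℂ) (s : ℝ) : ℂ :=
  (1 - Complex.I * z * s) * Complex.exp (Complex.I * z * s) / s ^ 3

lemma measurable_dker (z : ℂ) : Measurable (dker z) := by
  unfold dker; fun_prop

lemma hasDerivAt_sker (z : ℂ) {s : ℝ} (hs : s ≠ 0) : HasDerivAt (sker z) (-(s * dker z s)) s := by
  have hs' : (s : ℂ) ≠ 0 := by exact_mod_cast hs
  have h1 : HasDerivAt (fun s : ℝ => (s : ℂ)) 1 s := (hasDerivAt_id s).ofReal_comp
  refine (((h1.const_mul (Complex.I * z)).cexp).div h1 hs').congr_deriv ?_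
  rw [dker]
  field_simp
  ring

lemma hasFDerivAt_sker_dist (z : ℂ) (ξ : E3) {ε : ℝ} {η : E3} (h : 0 < ‖η - ξ‖ ^ 2 + ε) :
    HasFDerivAt (fun η : E3 => sker z √(‖η - ξ‖ ^ 2 + ε))
      ((ContinuousLinearMap.toSpanSingleton ℝ (-dker z √(‖η - ξ‖ ^ 2 + ε))) ∘L
        innerSL ℝ (η - ξ)) η := by
  have h1 := ((((hasFDerivAt_id η).sub_const ξ).norm_sq).add_const ε).sqrt h.ne'
  have hs : √(‖η - ξ‖ ^ 2 + ε) ≠ 0 := (Real.sqrt_pos.2 h).ne'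
  have h2 := (hasDerivAt_sker z hs).hasFDerivAt.comp η h1
  refine h2.congr_fderiv ?_
  ext v
  simp only [id, ContinuousLinearMap.comp_apply, smul_apply,
    ContinuousLinearMap.toSpanSingleton_apply, innerSL_apply_apply,
    ContinuousLinearMap.id_apply, Complex.real_smul, smul_eq_mul, nsmul_eq_mul]
  have hs' : ((√(‖η - ξ‖ ^ 2 + ε) : ℝ) : ℂ) ≠ 0 := by exact_mod_cast hs
  push_cast
  field_simp

lemma pd_sker_dist (z : ℂ) (ξ : E3) {ε : ℝ} {η : E3} (h : 0 < ‖η - ξ‖ ^ 2 + ε) (i : Fin 3) :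
    pd i (fun η : E3 => sker z √(‖η - ξ‖ ^ 2 + ε)) η
      = -dker z √(‖η - ξ‖ ^ 2 + ε) * ((η i : ℂ) - ξ i) := by
  rw [pd, (hasFDerivAt_sker_dist z ξ h).fderiv]
  simp [EuclideanSpace.inner_single_right]
  ring

lemma contDiff_sker_dist (z : ℂ) (ξ : E3) {ε : ℝ} (hε : 0 < ε) :
    ContDiff ℝ 1 (fun η : E3 => sker z √(‖η - ξ‖ ^ 2 + ε)) := by
  have h0 (η : E3) : ‖η - ξ‖ ^ 2 + ε ≠ 0 := by positivity
  have h1 : ContDiff ℝ 1 (fun η : E3 => ((√(‖η - ξ‖ ^ 2 + ε) : ℝ) : ℂ)) :=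
    Complex.ofRealCLM.contDiff.comp
      ((((contDiff_id.sub contDiff_const).norm_sq ℝ).add contDiff_const).sqrt h0)
  simp only [sker, div_eq_mul_inv]
  refine (contDiff_const.mul h1).cexp.mul (h1.inv fun η => ?_)
  have : √(‖η - ξ‖ ^ 2 + ε) ≠ 0 := (Real.sqrt_pos.2 (by positivity)).ne'
  exact_mod_cast this

lemma angDeriv_sker_dist (z : ℂ) (ξ : E3) {ε : ℝ} {η : E3} (h : 0 < ‖η - ξ‖ ^ 2 + ε) (j : Fin 3) :
    angDeriv j (fun η : E3 => sker z √(‖η - ξ‖ ^ 2 + ε)) η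
      = dker z √(‖η - ξ‖ ^ 2 + ε) * ev (rot j (dotP ξ)) η := by
  simp only [angDeriv, pd_sker_dist z ξ h, ev_rot_dotP]
  ring

/-- A polynomial that vanishes at `ξ` is `O(|ξ - η|)` on the sphere. -/
lemma exists_le_dist {ξ : E3} (hξ : ξ ∈ sphere (0 : E3) 1) (p : Poly) (hp : ev p ξ = 0) :
    ∃ K, 0 ≤ K ∧ ∀ η ∈ sphere (0 : E3) 1, ‖ev p η‖ ≤ K * ‖ξ - η‖ := by
  have hc : Continuous (fderiv ℝ (ev p)) := (contDiff_ev p).continuous_fderiv (by simp)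
  obtain ⟨K, hK⟩ := (isCompact_closedBall (0 : E3) 1).exists_bound_of_continuousOn hc.continuousOn
  have h0 : 0 ≤ K := (norm_nonneg _).trans (hK 0 (by simp))
  refine ⟨K, h0, fun η hη => ?_⟩
  have := (convex_closedBall (0 : E3) 1).norm_image_sub_le_of_norm_fderiv_le
    (fun x _ => differentiable_ev p x) hK (sphere_subset_closedBall hξ)
    (sphere_subset_closedBall hη)
  rwa [hp, sub_zero, norm_sub_rev] at this

lemma norm_dker_le (z : ℂ) {s : ℝ} (h0 : 0 ≤ s) (h3 : s ≤ 3) :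
    ‖dker z s‖ ≤ (1 + 3 * ‖z‖) * Real.exp (3 * ‖z‖) * (s ^ 3)⁻¹ := by
  rw [dker, norm_div, norm_mul, norm_pow, Complex.norm_real, Real.norm_eq_abs, abs_of_nonneg h0,
    div_eq_mul_inv]
  gcongr
  · refine (norm_sub_le _ _).trans ?_
    rw [norm_mul, norm_mul, Complex.norm_real, Real.norm_eq_abs, abs_of_nonneg h0]
    simp
    nlinarith [norm_nonneg z]
  · exact norm_exp_le z h0 h3

lemma norm_sker_le (z : ℂ) {s : ℝ} (h0 : 0 ≤ s) (h3 : s ≤ 3) :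
    ‖sker z s‖ ≤ Real.exp (3 * ‖z‖) * s⁻¹ := by
  rw [sker, norm_div, Complex.norm_real, Real.norm_eq_abs, abs_of_nonneg h0, div_eq_mul_inv]
  gcongr
  exact norm_exp_le z h0 h3

lemma norm_sub_pos_of_ne {ξ η : E3} (h : ξ ≠ η) : 0 < ‖ξ - η‖ := norm_pos_iff.2 (sub_ne_zero.2 h)

/-- The bounds behind dominated convergence: regularisation only weakens the singularity. -/
lemma regularized_bounds {ξ η : E3} (hξ : ξ ∈ sphere (0 : E3) 1) (hη : η ∈ sphere (0 : E3) 1)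
    (hne : ξ ≠ η) (z : ℂ) {ε : ℝ} (h0 : 0 ≤ ε) (h1 : ε ≤ 1) :
    ‖sker z √(‖η - ξ‖ ^ 2 + ε)‖ ≤ Real.exp (3 * ‖z‖) * ‖ξ - η‖⁻¹ ∧
    ‖dker z √(‖η - ξ‖ ^ 2 + ε)‖
      ≤ (1 + 3 * ‖z‖) * Real.exp (3 * ‖z‖) * (‖ξ - η‖ ^ 3)⁻¹ := by
  have hpos := norm_sub_pos_of_ne hne
  have h2 := dist_le_two hξ hη
  rw [norm_sub_rev η ξ]
  have hle : ‖ξ - η‖ ≤ √(‖ξ - η‖ ^ 2 + ε) := Real.le_sqrt_of_sq_le (by linarith)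
  have h3 : √(‖ξ - η‖ ^ 2 + ε) ≤ 3 := by
    rw [Real.sqrt_le_left (by norm_num)]; nlinarith
  constructor
  · refine (norm_sker_le z (Real.sqrt_nonneg _) h3).trans ?_
    gcongr
  · refine (norm_dker_le z (Real.sqrt_nonneg _) h3).trans ?_
    gcongr

lemma integrable_dker_mul {ξ : E3} (hξ : ξ ∈ sphere (0 : E3) 1) (z : ℂ) (p q : Poly)
    (hp : ev p ξ = 0) (hq : ev q ξ = 0) :
    Integrable (fun η : S2 => dker z ‖ξ - η‖ * (ev p η * ev q η)) sig := by
  obtain ⟨K, hK0, hK⟩ := exists_le_dist hξ p hp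
  obtain ⟨K', hK0', hK'⟩ := exists_le_dist hξ q hq
  refine integrable_of_le_inv_dist hξ ?_
    ((1 + 3 * ‖z‖) * Real.exp (3 * ‖z‖) * (K * K')) fun η hη => ?_
  · exact (((measurable_dker z).comp (measurable_dist ξ)).mul
      ((((continuous_ev p).mul (continuous_ev q)).measurable.comp
        measurable_subtype_coe))).aestronglyMeasurable
  · have hpos := norm_sub_pos_of_ne hη
    rw [norm_mul, norm_mul]
    calc _ ≤ ((1 + 3 * ‖z‖) * Real.exp (3 * ‖z‖) * (‖ξ - η‖ ^ 3)⁻¹)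
          * ((K * ‖ξ - η‖) * (K' * ‖ξ - η‖)) := by
          gcongr
          · exact norm_dker_le z hpos.le ((dist_le_two hξ η.2).trans (by norm_num))
          · exact hK η η.2
          · exact hK' η η.2
      _ = _ := by field_simp

/-- Integration by parts against the weakly singular kernel `F(s) = e^{izs} / s`, for a
polynomial that vanishes at the singularity. -/
lemma integral_dker_mul_rot {ξ : E3} (hξ : ξ ∈ sphere (0 : E3) 1) (z : ℂ) (j : Fin 3) (p : Poly)
    (hp : ev p ξ = 0) :
    ∫ η : S2, dker z ‖ξ - η‖ * (ev (rot j (dotP ξ)) η * ev p η) ∂sig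
      = -∫ η : S2, sker z ‖ξ - η‖ * ev (rot j p) η ∂sig := by
  have hq : ev (rot j (dotP ξ)) ξ = 0 := by rw [ev_rot_dotP]; ring
  obtain ⟨K, hK0, hK⟩ := exists_le_dist hξ _ hq
  obtain ⟨K', hK0', hK'⟩ := exists_le_dist hξ p hp
  obtain ⟨M, hM⟩ := (isCompact_sphere (0 : E3) 1).exists_bound_of_continuousOn
    (continuous_ev (rot j p)).continuousOn
  have hev : ∀ᶠ ε in nhdsWithin (0 : ℝ) (Ioi 0), 0 < ε ∧ ε ≤ 1 := by
    filter_upwards [self_mem_nhdsWithin, nhdsWithin_le_nhds (Iic_mem_nhds (zero_lt_one' ℝ))]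
      with ε h1 h2 using ⟨h1, h2⟩
  have hmeas (ε : ℝ) : Measurable fun η : S2 => √(‖(η : E3) - ξ‖ ^ 2 + ε) :=
    (by fun_prop : Continuous fun η : S2 => √(‖(η : E3) - ξ‖ ^ 2 + ε)).measurable
  have hmp (q : Poly) : Measurable fun η : S2 => ev q η :=
    (continuous_ev q).measurable.comp measurable_subtype_coe
  have hsqrt (η : S2) : Filter.Tendsto (fun ε : ℝ => √(‖(η : E3) - ξ‖ ^ 2 + ε))
      (nhdsWithin 0 (Ioi 0)) (nhds ‖ξ - η‖) := by
    have hc : Continuous fun ε : ℝ => √(‖(η : E3) - ξ‖ ^ 2 + ε) := by fun_prop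
    have := hc.tendsto 0
    simp only [add_zero, Real.sqrt_sq (norm_nonneg _), norm_sub_rev (η : E3) ξ] at this ⊢
    exact this.mono_left nhdsWithin_le_nhds
  have hcs {s : ℝ} (hs : 0 < s) : ContinuousAt (sker z) s :=
    (hasDerivAt_sker z hs.ne').continuousAt
  have hcd {s : ℝ} (hs : 0 < s) : ContinuousAt (dker z) s := by
    unfold dker
    refine ContinuousAt.div (by fun_prop) (by fun_prop) ?_
    have : (s : ℂ) ≠ 0 := by exact_mod_cast hs.ne'
    positivity
  have t1 := tendsto_integral_filter_of_dominated_convergence (μ := sig)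
    (F := fun (ε : ℝ) (η : S2) => dker z √(‖(η : E3) - ξ‖ ^ 2 + ε)
      * (ev (rot j (dotP ξ)) η * ev p η))
    (f := fun η : S2 => dker z ‖ξ - η‖ * (ev (rot j (dotP ξ)) η * ev p η))
    (l := nhdsWithin 0 (Ioi 0))
    (fun η : S2 => ((1 + 3 * ‖z‖) * Real.exp (3 * ‖z‖) * (K * K')) * ‖ξ - η‖⁻¹)
    (.of_forall fun ε => (((measurable_dker z).comp (hmeas ε)).mul
      ((hmp _).mul (hmp _))).aestronglyMeasurable)
    (by
      filter_upwards [hev] with ε hε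
      filter_upwards [ae_ne hξ] with η hη
      have hpos := norm_sub_pos_of_ne hη
      rw [norm_mul, norm_mul]
      calc _ ≤ ((1 + 3 * ‖z‖) * Real.exp (3 * ‖z‖) * (‖ξ - η‖ ^ 3)⁻¹)
            * ((K * ‖ξ - η‖) * (K' * ‖ξ - η‖)) := by
            gcongr
            · exact (regularized_bounds hξ η.2 hη z hε.1.le hε.2).2
            · exact hK η η.2
            · exact hK' η η.2
        _ = _ := by field_simp)
    ((integrable_inv_dist hξ).const_mul _)
    (by
      filter_upwards [ae_ne hξ] with η hη
      exact ((hcd (norm_sub_pos_of_ne hη)).tendsto.comp (hsqrt η)).mul_const _)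
  have t2 := tendsto_integral_filter_of_dominated_convergence (μ := sig)
    (F := fun (ε : ℝ) (η : S2) => sker z √(‖(η : E3) - ξ‖ ^ 2 + ε) * ev (rot j p) η)
    (f := fun η : S2 => sker z ‖ξ - η‖ * ev (rot j p) η)
    (l := nhdsWithin 0 (Ioi 0))
    (fun η : S2 => (Real.exp (3 * ‖z‖) * M) * ‖ξ - η‖⁻¹)
    (.of_forall fun ε => (((measurable_sker z).comp (hmeas ε)).mul
      (hmp _)).aestronglyMeasurable)
    (by
      filter_upwards [hev] with ε hε
      filter_upwards [ae_ne hξ] with η hη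
      rw [norm_mul]
      calc _ ≤ (Real.exp (3 * ‖z‖) * ‖ξ - η‖⁻¹) * M := by
            gcongr
            · exact (regularized_bounds hξ η.2 hη z hε.1.le hε.2).1
            · exact hM η η.2
        _ = _ := by ring)
    ((integrable_inv_dist hξ).const_mul _)
    (by
      filter_upwards [ae_ne hξ] with η hη
      exact ((hcs (norm_sub_pos_of_ne hη)).tendsto.comp (hsqrt η)).mul_const _)
  -- for `ε > 0` the kernel is smooth, and the identity is `integral_angDeriv` of a product
  refine tendsto_nhds_unique t1 (t2.neg.congr' ?_)
  filter_upwards [hev] with ε hε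
  have hpos (η : E3) : 0 < ‖η - ξ‖ ^ 2 + ε := by have := hε.1; positivity
  have hcd1 := contDiff_sker_dist z ξ hε.1
  have hp1 : ContDiff ℝ 1 (ev p) := (contDiff_ev p).of_le (by simp)
  have hdv (η : S2) : angDeriv j (fun η : E3 => sker z √(‖η - ξ‖ ^ 2 + ε) * ev p η) η
      = dker z √(‖(η : E3) - ξ‖ ^ 2 + ε) * (ev (rot j (dotP ξ)) η * ev p η)
        + sker z √(‖(η : E3) - ξ‖ ^ 2 + ε) * ev (rot j p) η := by
    rw [angDeriv_mul (hcd1.differentiable (by simp) _) (differentiable_ev p _),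
      angDeriv_sker_dist z ξ (hpos η), angDeriv_ev]
    ring
  have h0 := integral_angDeriv (hcd1.mul hp1) j
  have i2 : Integrable (fun η : S2 => sker z √(‖(η : E3) - ξ‖ ^ 2 + ε) * ev (rot j p) η) sig :=
    integrable_sphere (hcd1.continuous.mul (continuous_ev _))
  have i1 : Integrable (fun η : S2 => dker z √(‖(η : E3) - ξ‖ ^ 2 + ε)
      * (ev (rot j (dotP ξ)) η * ev p η)) sig := by
    refine ((integrable_sphere (continuous_angDeriv (hcd1.mul hp1) j)).sub i2).congr
      (.of_forall fun η => ?_)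
    simp only [Pi.sub_apply]
    rw [hdv]
    ring
  simp only [hdv] at h0
  rw [integral_add i1 i2] at h0
  linear_combination -h0

/-! ### Spherical Bessel and Hankel functions -/

/-- The functions `z ^ (n + 1) f_n(z)` attached to the sequence of spherical Bessel functions `f_n`
with `f_0(z) = A(z) / z`, where `A'' = -A` and `B = A'`. They are defined by the three-term
recurrence, so that they are entire: no division by `z` occurs. -/
noncomputable def bes (A B : ℂ → ℂ) : ℕ → ℂ → ℂ
  | 0 => A
  | 1 => fun z => A z - z * B z
  | n + 2 => fun z => (2 * n + 3) * bes A B (n + 1) z - z ^ 2 * bes A B n z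

lemma bes_add_two (A B : ℂ → ℂ) (n : ℕ) (z : ℂ) :
    bes A B (n + 2) z = (2 * n + 3) * bes A B (n + 1) z - z ^ 2 * bes A B n z := by
  rw [bes]

/-- The two first order relations between consecutive members of the sequence:
`f_{n+1} = (2n + 1) f_n - z f_n'` and `f_{n+1}' = z f_n`, in the normalisation of `bes`. -/
lemma bes_deriv_aux {A B : ℂ → ℂ} (hA : ∀ z, HasDerivAt A (B z) z)
    (hB : ∀ z, HasDerivAt B (-A z) z) (n : ℕ) (z : ℂ) :
    (∃ d, HasDerivAt (bes A B n) d z ∧ bes A B (n + 1) z = (2 * n + 1) * bes A B n z - z * d) ∧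
      HasDerivAt (bes A B (n + 1)) (z * bes A B n z) z := by
  induction n with
  | zero =>
    refine ⟨⟨B z, hA z, by simp [bes]⟩, ?_⟩
    refine ((hA z).sub ((hasDerivAt_id z).mul (hB z))).congr_deriv ?_
    simp [bes]
  | succ n ih =>
    obtain ⟨⟨d, hd, h⟩, h1⟩ := ih
    refine ⟨⟨_, h1, ?_⟩, ?_⟩
    · rw [bes_add_two]; push_cast; ring
    · refine ((h1.const_mul (2 * (n : ℂ) + 3)).sub
        (((hasDerivAt_id z).pow 2).mul hd)).congr_deriv ?_
      rw [h]
      simp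
      ring

/-- `z^{n+1} j_n(z)`. -/
noncomputable def besJ : ℕ → ℂ → ℂ := bes Complex.sin Complex.cos

/-- `z^{n+1} h_n^{(1)}(z)`. -/
noncomputable def besH : ℕ → ℂ → ℂ :=
  bes (fun z => Complex.exp (Complex.I * z) / Complex.I) (fun z => Complex.exp (Complex.I * z))

lemma hasDerivAt_exp_I (z : ℂ) : HasDerivAt (fun z => Complex.exp (Complex.I * z))
    (Complex.I * Complex.exp (Complex.I * z)) z :=
  (((hasDerivAt_id z).const_mul Complex.I).cexp).congr_deriv (by simp; ring)

lemma hasDerivAt_hankelBase (z : ℂ) :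
    HasDerivAt (fun z => Complex.exp (Complex.I * z) / Complex.I) (Complex.exp (Complex.I * z)) z :=
  ((hasDerivAt_exp_I z).div_const Complex.I).congr_deriv (by field_simp)

lemma hasDerivAt_exp_I' (z : ℂ) : HasDerivAt (fun z => Complex.exp (Complex.I * z))
    (-(Complex.exp (Complex.I * z) / Complex.I)) z :=
  (hasDerivAt_exp_I z).congr_deriv (by field_simp; simp)

lemma besJ_aux (n : ℕ) (z : ℂ) :
    (∃ d, HasDerivAt (besJ n) d z ∧ besJ (n + 1) z = (2 * n + 1) * besJ n z - z * d) ∧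
      HasDerivAt (besJ (n + 1)) (z * besJ n z) z :=
  bes_deriv_aux Complex.hasDerivAt_sin Complex.hasDerivAt_cos n z

lemma besH_aux (n : ℕ) (z : ℂ) :
    (∃ d, HasDerivAt (besH n) d z ∧ besH (n + 1) z = (2 * n + 1) * besH n z - z * d) ∧
      HasDerivAt (besH (n + 1)) (z * besH n z) z :=
  bes_deriv_aux hasDerivAt_hankelBase hasDerivAt_exp_I' n z

lemma besJ_add_two (n : ℕ) (z : ℂ) :
    besJ (n + 2) z = (2 * n + 3) * besJ (n + 1) z - z ^ 2 * besJ n z := bes_add_two _ _ n z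

lemma besH_add_two (n : ℕ) (z : ℂ) :
    besH (n + 2) z = (2 * n + 3) * besH (n + 1) z - z ^ 2 * besH n z := bes_add_two _ _ n z

/-- The Wronskian of `j_n` and `h_n^{(1)}`. -/
lemma bes_wronskian (n : ℕ) (z : ℂ) :
    besJ (n + 1) z * besH n z - besJ n z * besH (n + 1) z = Complex.I * z ^ (2 * n + 1) := by
  induction n with
  | zero =>
    have h1 : Complex.exp (Complex.I * z) = Complex.cos z + Complex.sin z * Complex.I := by
      rw [mul_comm, Complex.exp_mul_I]
    have h2 := Complex.sin_sq_add_cos_sq z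
    simp only [besJ, besH, bes, h1]
    field_simp
    linear_combination (-z) * h2 + (z * Complex.sin z ^ 2 - z) * Complex.I_sq
  | succ n ih =>
    rw [besJ_add_two, besH_add_two]
    linear_combination z ^ 2 * ih

/-- Rayleigh's formula produces the sequence `bes`. -/
lemma rayleigh_eq {A B f : ℂ → ℂ} (hA : ∀ z, HasDerivAt A (B z) z)
    (hB : ∀ z, HasDerivAt B (-A z) z) (hf : ∀ z, f z = A z / z) (n : ℕ) {z : ℂ} (hz : z ≠ 0) :
    rayleigh f n z = bes A B n z / z ^ (n + 1) := by
  have key (n : ℕ) : ∀ z : ℂ, z ≠ 0 → ((fun (g : ℂ → ℂ) (w : ℂ) => deriv g w / w)^[n] f) z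
      = (-1) ^ n * (bes A B n z / z ^ (2 * n + 1)) := by
    induction n with
    | zero => intro z hz; simp [bes, hf]
    | succ n ih =>
      intro z hz
      rw [Function.iterate_succ_apply']
      obtain ⟨d, hd, h⟩ := (bes_deriv_aux hA hB n z).1
      have he : ((fun (g : ℂ → ℂ) (w : ℂ) => deriv g w / w)^[n] f)
          =ᶠ[nhds z] fun z => (-1) ^ n * (bes A B n z / z ^ (2 * n + 1)) := by
        filter_upwards [isOpen_ne.mem_nhds hz] with w hw using ih w hw
      have hd2 := (hd.div ((hasDerivAt_id z).pow (2 * n + 1))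
        (pow_ne_zero _ hz)).const_mul ((-1 : ℂ) ^ n)
      rw [he.deriv_eq]
      have := hd2.deriv
      simp only [id] at this
      erw [this]
      rw [h]
      have e1 : z ^ (2 * n + 1) = z ^ (2 * n) * z := pow_succ _ _
      have e2 : z ^ (2 * (n + 1) + 1) = z ^ (2 * n) * z ^ 3 := by rw [← pow_add]; ring_nf
      simp only [Nat.add_sub_cancel, e2, pow_succ (-1 : ℂ) n]
      push_cast
      simp only [Pi.pow_apply, id, e1]
      field_simp
      ring
  rw [rayleigh, key n z hz, neg_pow z n]
  have e : ((-1 : ℂ) ^ n) * (-1) ^ n = 1 := by rw [← mul_pow]; simp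
  have e1 : z ^ (2 * n + 1) = z ^ n * z ^ (n + 1) := by rw [← pow_add]; ring_nf
  rw [e1]
  have := pow_ne_zero n hz
  field_simp
  linear_combination bes A B n z * e

lemma sphJ_eq (n : ℕ) {z : ℂ} (hz : z ≠ 0) : sphJ n z = besJ n z / z ^ (n + 1) :=
  rayleigh_eq Complex.hasDerivAt_sin Complex.hasDerivAt_cos (fun _ => rfl) n hz

lemma sphH_eq (n : ℕ) {z : ℂ} (hz : z ≠ 0) : sphH n z = besH n z / z ^ (n + 1) :=
  rayleigh_eq hasDerivAt_hankelBase hasDerivAt_exp_I' (fun w => by rw [div_div]) n hz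

lemma deriv_sphJ (n : ℕ) {z : ℂ} (hz : z ≠ 0) :
    deriv (sphJ n) z = (n * besJ n z - besJ (n + 1) z) / z ^ (n + 2) := by
  obtain ⟨d, hd, h⟩ := (besJ_aux n z).1
  have he : sphJ n =ᶠ[nhds z] fun z => besJ n z / z ^ (n + 1) := by
    filter_upwards [isOpen_ne.mem_nhds hz] with w hw using sphJ_eq n hw
  have hd2 := hd.div (hasDerivAt_pow (n + 1) z) (pow_ne_zero _ hz)
  rw [he.deriv_eq]
  refine hd2.deriv.trans ?_
  rw [h]
  simp only [Nat.add_sub_cancel, pow_succ]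
  push_cast
  field_simp
  ring

lemma chi_eq (n : ℕ) {k : ℂ} {R : ℝ} (hR : R ≠ 0) (hk : k ≠ 0) :
    chi n k R / R = -Complex.I * besJ n (k * R) * besH n (k * R) / (k * R) ^ (2 * n + 1) := by
  have hR' : (R : ℂ) ≠ 0 := by exact_mod_cast hR
  have hz : k * R ≠ 0 := mul_ne_zero hk hR'
  rw [chi, sphJ_eq n hz, sphH_eq n hz]
  have e : (k * R) ^ (2 * n + 1) = (k * R) ^ n * (k * R) ^ n * (k * R) := by ring
  rw [e, pow_succ _ n]
  have := pow_ne_zero n hz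
  generalize besJ n (k * R) = a
  generalize besH n (k * R) = b
  generalize (k * R) ^ n = c at *
  field_simp

lemma lam_eq (n : ℕ) {k : ℂ} {R : ℝ} (hR : R ≠ 0) (hk : k ≠ 0) :
    lam n k R = 1 / 2 - Complex.I * (n * besJ n (k * R) - besJ (n + 1) (k * R)) * besH n (k * R)
      / (k * R) ^ (2 * n + 1) := by
  have hR' : (R : ℂ) ≠ 0 := by exact_mod_cast hR
  have hz : k * R ≠ 0 := mul_ne_zero hk hR'
  rw [lam, deriv_sphJ n hz, sphH_eq n hz]
  have e : (k * R) ^ (2 * n + 1) = (k * R) ^ n * (k * R) ^ n * (k * R) := by ring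
  rw [e, pow_succ _ n, pow_add _ n 2]
  have := pow_ne_zero n hz
  generalize besJ n (k * R) = a
  generalize besJ (n + 1) (k * R) = a'
  generalize besH n (k * R) = b
  generalize (k * R) ^ n = c at *
  field_simp

lemma two_mul_add_one_ne (n : ℕ) : (2 * (n : ℂ) + 1) ≠ 0 := by
  exact_mod_cast (by omega : 2 * n + 1 ≠ 0)

/-- The two eigenvalues are opposite to each other. -/
lemma m1_eq_neg_m2 (n : ℕ) (hn : 1 ≤ n) {k : ℂ} {R : ℝ} (hR : R ≠ 0) (hk : k ≠ 0) :
    m1 n k R = -m2 n k R := by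
  obtain ⟨m, rfl⟩ : ∃ m, n = m + 1 := ⟨n - 1, by omega⟩
  have hR' : (R : ℂ) ≠ 0 := by exact_mod_cast hR
  have hz : k * R ≠ 0 := mul_ne_zero hk hR'
  have c0 := chi_eq m hR hk
  have c1 := chi_eq (m + 1) hR hk
  have c2 := chi_eq (m + 2) hR hk
  have l0 := lam_eq m hR hk
  have l1 := lam_eq (m + 1) hR hk
  have l2 := lam_eq (m + 2) hR hk
  have hw := bes_wronskian m (k * R)
  have hsplit : m1 (m + 1) k R = ((m + 2) * lam m k R + (m + 1) * lam (m + 2) k R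
      + (m + 2) * (chi m k R / R) + (m + 1) * (chi (m + 2) k R / R)
      - (m + 1) * (m + 2) * (chi m k R / R - chi (m + 2) k R / R)) / (2 * m + 3) := by
    have h3 : (2 * ((m : ℂ) + 1) + 1) ≠ 0 := by exact_mod_cast two_mul_add_one_ne (m + 1)
    have h3' : (2 * (m : ℂ) + 3) ≠ 0 := by convert h3 using 1; ring
    simp only [m1, pi1, sigma1, sigma3, Nat.add_sub_cancel, Nat.cast_add, Nat.cast_one]
    rw [show (2 * ((m : ℂ) + 1) + 1) = 2 * m + 3 by ring]
    field_simp
    ring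
  have h3' : (2 * (m : ℂ) + 3) ≠ 0 := by
    convert two_mul_add_one_ne (m + 1) using 1; push_cast; ring
  rw [hsplit, m2, c0, c1, c2, l0, l1, l2]
  have e1 : (k * R) ^ (2 * (m + 1) + 1) = (k * R) ^ (2 * m + 1) * (k * R) ^ 2 := by
    rw [← pow_add]; ring_nf
  have e2 : (k * R) ^ (2 * (m + 2) + 1) = (k * R) ^ (2 * m + 1) * (k * R) ^ 4 := by
    rw [← pow_add]; ring_nf
  have hwz := pow_ne_zero (2 * m + 1) hz
  have a3 : besJ (m + 3) (k * R) = _ := besJ_add_two (m + 1) (k * R)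
  rw [e1, e2]
  simp only [add_assoc, Nat.reduceAdd] at *
  rw [a3, besJ_add_two m, besH_add_two m]
  generalize besJ m (k * R) = a at *
  generalize besJ (m + 1) (k * R) = b at *
  generalize besH m (k * R) = A at *
  generalize besH (m + 1) (k * R) = B at *
  generalize (k * R) ^ (2 * m + 1) = w at *
  generalize k * R = z at *
  -- the terms bilinear in the Bessel functions add up to a multiple of the Wronskian, which
  -- cancels the sum `1` of the two constants `1 / 2`
  have hkey : ∀ x y : ℂ, (b * A - a * B) = Complex.I * w → x = y + Complex.I / w *
    (b * A - a * B) + 1 → x = y := by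
    intro x y h1 h2
    rw [h2, h1]
    field_simp
    linear_combination Complex.I_sq
  refine hkey _ _ hw ?_
  push_cast
  rw [div_eq_iff h3']
  field_simp
  ring

/-! ### Harmonic polynomials -/

lemma pderiv_comm (i j : Fin 3) (p : Poly) : pderiv i (pderiv j p) = pderiv j (pderiv i p) := by
  have h : ⁅(pderiv i : Derivation ℂ Poly Poly), (pderiv j : Derivation ℂ Poly Poly)⁆ = 0 := by
    apply MvPolynomial.derivation_ext
    intro l
    rw [Derivation.commutator_apply]
    simp [MvPolynomial.pderiv_X, Pi.single_apply, apply_ite]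
  have h2 := congrArg (fun D => D p) h
  simp only [Derivation.commutator_apply, Derivation.zero_apply] at h2
  exact sub_eq_zero.1 h2

/-- The Laplacian of a polynomial. -/
noncomputable def lap (p : Poly) : Poly := ∑ i, pderiv i (pderiv i p)

/-- Homogeneous harmonic polynomials of degree `n`. -/
def IsHarm (n : ℕ) (p : Poly) : Prop := p.IsHomogeneous n ∧ lap p = 0

lemma lap_add (p q : Poly) : lap (p + q) = lap p + lap q := by
  simp [lap, Finset.sum_add_distrib]

lemma lap_sub (p q : Poly) : lap (p - q) = lap p - lap q := by
  simp [lap, Finset.sum_sub_distrib]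

lemma pderiv_C_mul' (i : Fin 3) (c : ℂ) (p : Poly) : pderiv i (C c * p) = C c * pderiv i p := by
  simp [Derivation.leibniz]

lemma lap_C_mul (c : ℂ) (p : Poly) : lap (C c * p) = C c * lap p := by
  simp only [lap, pderiv_C_mul', Finset.mul_sum]

lemma lap_pderiv (i : Fin 3) (p : Poly) : lap (pderiv i p) = pderiv i (lap p) := by
  simp only [lap, map_sum, pderiv_comm _ i]

lemma lap_X_mul (i : Fin 3) (p : Poly) : lap (X i * p) = 2 * pderiv i p + X i * lap p := by
  simp only [lap, Fin.sum_univ_three, Derivation.leibniz, smul_eq_mul, map_add]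
  fin_cases i <;> simp [MvPolynomial.pderiv_X] <;> ring

lemma euler {n : ℕ} {p : Poly} (h : p.IsHomogeneous n) :
    X 0 * pderiv 0 p + X 1 * pderiv 1 p + X 2 * pderiv 2 p = (n : Poly) * p := by
  have := h.sum_X_mul_pderiv
  rwa [Fin.sum_univ_three, nsmul_eq_mul] at this

lemma euler_pderiv {n : ℕ} {p : Poly} (h : p.IsHomogeneous n) (i : Fin 3) :
    X 0 * pderiv 0 (pderiv i p) + X 1 * pderiv 1 (pderiv i p) + X 2 * pderiv 2 (pderiv i p)
      = ((n : Poly) - 1) * pderiv i p := by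
  have h1 := congrArg (pderiv i) (euler h)
  rw [pderiv_comm 0 i, pderiv_comm 1 i, pderiv_comm 2 i]
  simp only [Derivation.leibniz, smul_eq_mul, map_add] at h1
  fin_cases i <;> simp [MvPolynomial.pderiv_X] at h1 ⊢ <;> linear_combination h1

@[simp] lemma ev_natCast (m : ℕ) (y : E3) : ev (m : Poly) y = m := by simp [ev]

lemma ev_euler {n : ℕ} {p : Poly} (h : p.IsHomogeneous n) (y : E3) :
    y 0 * ev (pderiv 0 p) y + y 1 * ev (pderiv 1 p) y + y 2 * ev (pderiv 2 p) y = n * ev p y := by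
  simpa using congrArg (fun q => ev q y) (euler h)

lemma IsHarm.pderiv {n : ℕ} {p : Poly} (h : IsHarm n p) (i : Fin 3) :
    IsHarm (n - 1) (pderiv i p) :=
  ⟨h.1.pderiv, by rw [lap_pderiv, h.2, map_zero]⟩

lemma IsHarm.add {n : ℕ} {p q : Poly} (hp : IsHarm n p) (hq : IsHarm n q) : IsHarm n (p + q) :=
  ⟨hp.1.add hq.1, by rw [lap_add, hp.2, hq.2, add_zero]⟩

lemma IsHarm.sub {n : ℕ} {p q : Poly} (hp : IsHarm n p) (hq : IsHarm n q) : IsHarm n (p - q) :=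
  ⟨hp.1.sub hq.1, by rw [lap_sub, hp.2, hq.2, sub_zero]⟩

lemma IsHarm.C_mul {n : ℕ} {p : Poly} (hp : IsHarm n p) (c : ℂ) : IsHarm n (C c * p) :=
  ⟨hp.1.C_mul c, by rw [lap_C_mul, hp.2, mul_zero]⟩

lemma isHarm_zero (n : ℕ) : IsHarm n 0 :=
  ⟨MvPolynomial.isHomogeneous_zero _ _ _, by simp [lap]⟩

lemma IsHarm.exists_eq_C {p : Poly} (h : IsHarm 0 p) : ∃ c, p = C c :=
  ⟨_, MvPolynomial.totalDegree_eq_zero_iff_eq_C.1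
    ((MvPolynomial.totalDegree_zero_iff_isHomogeneous _).2 h.1)⟩

lemma IsHarm.rot {n : ℕ} {p : Poly} (h : IsHarm n p) (j : Fin 3) : IsHarm n (rot j p) := by
  rcases n with _ | n
  · obtain ⟨c, rfl⟩ := IsHarm.exists_eq_C h
    simpa [MaxwellBall.rot] using isHarm_zero 0
  · refine ⟨?_, ?_⟩
    · have h1 (i l : Fin 3) : (X i * MvPolynomial.pderiv l p : Poly).IsHomogeneous (n + 1) := by
        have := (MvPolynomial.isHomogeneous_X ℂ i).mul (h.1.pderiv (i := l))
        rwa [Nat.add_sub_cancel, add_comm] at this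
      exact (h1 _ _).sub (h1 _ _)
    · rw [MaxwellBall.rot, lap_sub, lap_X_mul, lap_X_mul, lap_pderiv, lap_pderiv, h.2, map_zero,
        map_zero, pderiv_comm (j + 1)]
      ring

/-- The Laplace-Beltrami eigenvalue of a spherical harmonic, in polynomial form. -/
lemma sum_rot_rot {n : ℕ} {p : Poly} (h : IsHarm n p) :
    ∑ j, rot j (rot j p) = -((n : Poly) * (n + 1)) * p := by
  have e := euler h.1
  have e0 := euler_pderiv h.1 0
  have e1 := euler_pderiv h.1 1
  have e2 := euler_pderiv h.1 2
  have hl := h.2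
  simp only [lap, Fin.sum_univ_three] at hl ⊢
  simp only [rot, map_sub, Derivation.leibniz, smul_eq_mul, Fin.isValue, Fin.reduceAdd,
    MvPolynomial.pderiv_X]
  simp only [Fin.isValue, ne_eq, Fin.reduceEq, not_false_eq_true, Pi.single_eq_of_ne,
    Pi.single_eq_same, zero_ne_one, one_ne_zero]
  rw [pderiv_comm 1 0, pderiv_comm 2 0, pderiv_comm 2 1] at *
  linear_combination (X 0 ^ 2 + X 1 ^ 2 + X 2 ^ 2) * hl - X 0 * e0 - X 1 * e1 - X 2 * e2
    - ((n : Poly) + 1) * e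

/-! ### The single layer operator on spherical harmonics -/

/-- `∫ F(|ξ - η|) p(η) dσ(η)` with `F(s) = e^{izs} / s`. -/
noncomputable def sint (ξ : E3) (p : Poly) (z : ℂ) : ℂ :=
  ∫ η : S2, sker z ‖ξ - η‖ * ev p η ∂sig

/-- `∫ e^{iz|ξ - η|} p(η) dσ(η)`. -/
noncomputable def eint (ξ : E3) (p : Poly) (z : ℂ) : ℂ :=
  ∫ η : S2, Complex.exp (Complex.I * z * (‖ξ - η‖ : ℝ)) * ev p η ∂sig

lemma integrable_exp_mul (ξ : E3) (p : Poly) (z : ℂ) :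
    Integrable (fun η : S2 => Complex.exp (Complex.I * z * (‖ξ - η‖ : ℝ)) * ev p η) sig := by
  have : Continuous fun η : E3 => Complex.exp (Complex.I * z * (‖ξ - η‖ : ℝ)) * ev p η :=
    (by fun_prop : Continuous fun η : E3 => Complex.exp (Complex.I * z * (‖ξ - η‖ : ℝ))).mul
      (continuous_ev p)
  exact integrable_sphere this

lemma sint_add {ξ : E3} (hξ : ξ ∈ sphere (0 : E3) 1) (p q : Poly) (z : ℂ) :
    sint ξ (p + q) z = sint ξ p z + sint ξ q z := by
  simp only [sint, ev_add, mul_add]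
  exact integral_add (integrable_sker_mul hξ z (continuous_ev p))
    (integrable_sker_mul hξ z (continuous_ev q))

lemma sint_sub {ξ : E3} (hξ : ξ ∈ sphere (0 : E3) 1) (p q : Poly) (z : ℂ) :
    sint ξ (p - q) z = sint ξ p z - sint ξ q z := by
  simp only [sint, ev_sub, mul_sub]
  exact integral_sub (integrable_sker_mul hξ z (continuous_ev p))
    (integrable_sker_mul hξ z (continuous_ev q))

lemma sint_C_mul (ξ : E3) (c : ℂ) (p : Poly) (z : ℂ) : sint ξ (C c * p) z = c * sint ξ p z := by
  simp only [sint, ev_mul, ev_C, mul_left_comm _ c]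
  exact integral_const_mul _ _

lemma eint_add (ξ : E3) (p q : Poly) (z : ℂ) :
    eint ξ (p + q) z = eint ξ p z + eint ξ q z := by
  simp only [eint, ev_add, mul_add]
  exact integral_add (integrable_exp_mul ξ p z) (integrable_exp_mul ξ q z)

lemma eint_sub (ξ : E3) (p q : Poly) (z : ℂ) :
    eint ξ (p - q) z = eint ξ p z - eint ξ q z := by
  simp only [eint, ev_sub, mul_sub]
  exact integral_sub (integrable_exp_mul ξ p z) (integrable_exp_mul ξ q z)

lemma eint_C_mul (ξ : E3) (c : ℂ) (p : Poly) (z : ℂ) : eint ξ (C c * p) z = c * eint ξ p z := by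
  simp only [eint, ev_mul, ev_C, mul_left_comm _ c]
  exact integral_const_mul _ _

lemma hasDerivAt_sint {ξ : E3} (hξ : ξ ∈ sphere (0 : E3) 1) (p : Poly) (z : ℂ) :
    HasDerivAt (sint ξ p) (Complex.I * eint ξ p z) z := by
  obtain ⟨M, hM⟩ := (isCompact_sphere (0 : E3) 1).exists_bound_of_continuousOn
    (continuous_ev p).continuousOn
  have h := (hasDerivAt_integral_of_dominated_loc_of_deriv_le (μ := sig)
    (F := fun z (η : S2) => sker z ‖ξ - η‖ * ev p η)
    (F' := fun z (η : S2) => Complex.I * (Complex.exp (Complex.I * z * (‖ξ - η‖ : ℝ)) * ev p η))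
    (x₀ := z) (s := ball z 1) (bound := fun _ => Real.exp (3 * (‖z‖ + 1)) * M)
    (ball_mem_nhds z one_pos)
    (.of_forall fun w => (integrable_sker_mul hξ w (continuous_ev p)).aestronglyMeasurable)
    (integrable_sker_mul hξ z (continuous_ev p))
    ((integrable_exp_mul ξ p z).const_mul _).aestronglyMeasurable
    (.of_forall fun η w hw => ?_) (integrable_const _) ?_).2
  · rw [integral_const_mul] at h
    exact h
  · rw [norm_mul, Complex.norm_I, one_mul, norm_mul]
    gcongr
    · refine (norm_exp_le w (norm_nonneg _) ((dist_le_two hξ η.2).trans (by norm_num))).trans ?_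
      apply Real.exp_le_exp.2
      have h1 : ‖w‖ ≤ ‖z‖ + 1 := by
        have := norm_sub_norm_le w z
        rw [mem_ball_iff_norm] at hw
        linarith
      linarith
    · exact hM η η.2
  · filter_upwards [ae_ne hξ] with η hη w _
    have hs : ((‖ξ - η‖ : ℝ) : ℂ) ≠ 0 := by exact_mod_cast (norm_sub_pos_of_ne hη).ne'
    have h1 : HasDerivAt (fun w : ℂ => Complex.I * w * (‖ξ - η‖ : ℝ))
        (Complex.I * (‖ξ - η‖ : ℝ)) w := by
      simpa using ((hasDerivAt_id w).const_mul Complex.I).mul_const ((‖ξ - η‖ : ℝ) : ℂ)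
    refine ((h1.cexp.div_const _).mul_const _).congr_deriv ?_
    field_simp

/-- The directional derivative `ξ · ∇ p`. -/
noncomputable def dirP (ξ : E3) (p : Poly) : Poly := ∑ i, C (ξ i : ℂ) * pderiv i p

lemma ev_dirP (ξ : E3) (p : Poly) (y : E3) : ev (dirP ξ p) y
    = ξ 0 * ev (pderiv 0 p) y + ξ 1 * ev (pderiv 1 p) y + ξ 2 * ev (pderiv 2 p) y := by
  simp [dirP, Fin.sum_univ_three]

lemma IsHarm.dirP {n : ℕ} {p : Poly} (h : IsHarm n p) (ξ : E3) : IsHarm (n - 1) (dirP ξ p) := by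
  rw [MaxwellBall.dirP, Fin.sum_univ_three]
  exact (((h.pderiv 0).C_mul _).add ((h.pderiv 1).C_mul _)).add ((h.pderiv 2).C_mul _)

lemma ev_dirP_self {n : ℕ} {p : Poly} (h : IsHarm n p) (ξ : E3) :
    ev (dirP ξ p) ξ = n * ev p ξ := by
  rw [ev_dirP, ev_euler h.1]

lemma ev_dotP_self {ξ : E3} (hξ : ξ ∈ sphere (0 : E3) 1) : ev (dotP ξ) ξ = 1 := by
  rw [ev_dotP, ← sq_sum_coord hξ]; ring

lemma sum_rot_dotP_mul_rot {n : ℕ} {p : Poly} (h : IsHarm n p) (ξ : E3) {η : E3}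
    (hη : η ∈ sphere (0 : E3) 1) :
    ∑ j, ev (rot j (dotP ξ)) η * ev (rot j p) η
      = ev (dirP ξ p) η - n * ev (dotP ξ) η * ev p η := by
  have h1 := sq_sum_coord hη
  have h2 := ev_euler h.1 η
  simp only [Fin.sum_univ_three, ev_rot_dotP, ev_dotP, ev_dirP]
  simp only [rot, ev_sub, ev_mul, ev_X, Fin.isValue, Fin.reduceAdd]
  linear_combination (ξ 0 * ev (pderiv 0 p) η + ξ 1 * ev (pderiv 1 p) η
    + ξ 2 * ev (pderiv 2 p) η : ℂ) * h1 - (ξ 0 * η 0 + ξ 1 * η 1 + ξ 2 * η 2 : ℂ) * h2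

lemma one_sub_dotP {ξ η : E3} (hξ : ξ ∈ sphere (0 : E3) 1) (hη : η ∈ sphere (0 : E3) 1) :
    1 - ev (dotP ξ) η = ((‖ξ - η‖ : ℝ) : ℂ) ^ 2 / 2 := by
  have h := dist_sq hξ hη
  rw [ev_dotP_eq_inner, ← Complex.ofReal_pow, h]
  push_cast
  ring

lemma dker_mul_sq (z : ℂ) {s : ℝ} (hs : s ≠ 0) :
    dker z s * (s : ℂ) ^ 2 = sker z s - Complex.I * z * Complex.exp (Complex.I * z * s) := by
  have : (s : ℂ) ≠ 0 := by exact_mod_cast hs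
  rw [dker, sker]
  field_simp

/-- The recursion in the degree. With `W = (1 - ξ·η) LH / (n + 1) + H L(ξ·η)`, a field that
vanishes at `ξ`, it is the integration by parts of `F L·W`. -/
lemma degree_recursion {ξ : E3} (hξ : ξ ∈ sphere (0 : E3) 1) {n : ℕ} {H : Poly}
    (hH : IsHarm (n + 1) H) (z : ℂ) :
    Complex.I * z * (eint ξ (C (1 / (n + 1 : ℂ)) * dirP ξ H) z + eint ξ H z)
      = (2 * n + 1) * sint ξ (C (1 / (n + 1 : ℂ)) * dirP ξ H) z - (2 * n + 3) * sint ξ H z := by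
  have hn : (n + 1 : ℂ) ≠ 0 := by exact_mod_cast n.succ_ne_zero
  set Q : Poly := C (1 / (n + 1 : ℂ)) * dirP ξ H with hQ
  let W : Fin 3 → Poly := fun j =>
    C (1 / (n + 1 : ℂ)) * ((1 - dotP ξ) * rot j H) + H * rot j (dotP ξ)
  have hW (j : Fin 3) : ev (W j) ξ = 0 := by
    have : ev (rot j (dotP ξ)) ξ = 0 := by rw [ev_rot_dotP]; ring
    simp [W, this, ev_dotP_self hξ]
  have hQev (η : E3) : ev (dirP ξ H) η = (n + 1) * ev Q η := by
    rw [hQ, ev_mul, ev_C]; field_simp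
  have hsum := fun (η : S2) => sum_rot_dotP_mul_rot hH ξ η.2
  have hA (η : S2) : ∑ j, ev (rot j (dotP ξ)) η * ev (W j) η
      = (1 - ev (dotP ξ) η) * (ev Q η + ev H η) := by
    have h1 := hsum η
    have h2 := sum_rot_dotP_sq hξ η.2
    rw [hQev] at h1
    simp only [Fin.sum_univ_three, W, ev_add, ev_sub, ev_mul, ev_C, ev_one] at h1 h2 ⊢
    push_cast at h1
    field_simp
    linear_combination (1 - ev (dotP ξ) η) * h1 + ev H η * (n + 1) * h2
  have hB (η : S2) : ∑ j, ev (rot j (W j)) η = n * ev Q η - (n + 2) * ev H η := by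
    have h1 := hsum η
    have h2 := sum_rot_rot_dotP ξ η
    have h3 := congrArg (fun q => ev q (η : E3)) (sum_rot_rot hH)
    have h4 (j : Fin 3) : rot j (1 : Poly) = 0 := by simp [rot]
    rw [hQev] at h1
    simp only [W, rot_add, rot_C_mul]
    simp only [Fin.sum_univ_three, ev_add, ev_sub, ev_mul, ev_neg, ev_C, ev_one, rot_mul,
      rot_sub, h4, ev_zero, ev_natCast] at h1 h2 h3 ⊢
    push_cast at h1 h3
    field_simp
    linear_combination (1 - ev (dotP ξ) η) * h3 + n * h1 + ev H η * (n + 1) * h2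
  have hsumI : ∑ j, ∫ η : S2, dker z ‖ξ - η‖ * (ev (rot j (dotP ξ)) η * ev (W j) η) ∂sig
      = -∑ j, ∫ η : S2, sker z ‖ξ - η‖ * ev (rot j (W j)) η ∂sig := by
    rw [← Finset.sum_neg_distrib]
    exact Finset.sum_congr rfl fun j _ => integral_dker_mul_rot hξ z j (W j) (hW j)
  have hq0 (j : Fin 3) : ev (rot j (dotP ξ)) ξ = 0 := by rw [ev_rot_dotP]; ring
  rw [← integral_finsetSum _ fun j _ => integrable_dker_mul hξ z _ _ (hq0 j) (hW j),
    ← integral_finsetSum _ fun j _ => integrable_sker_mul hξ z (continuous_ev _)] at hsumI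
  simp only [← Finset.mul_sum, hA, hB] at hsumI
  have hL : ∫ η : S2, dker z ‖ξ - η‖ * ((1 - ev (dotP ξ) η) * (ev Q η + ev H η)) ∂sig
      = (sint ξ (Q + H) z - Complex.I * z * eint ξ (Q + H) z) / 2 := by
    rw [sint, eint, ← integral_const_mul, ← integral_sub
      (integrable_sker_mul hξ z (continuous_ev _)) ((integrable_exp_mul ξ _ z).const_mul _),
      ← integral_div]
    apply integral_congr_ae
    filter_upwards [ae_ne hξ] with η hη
    have := dker_mul_sq z (norm_sub_pos_of_ne hη).ne'
    rw [one_sub_dotP hξ η.2, ev_add]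
    linear_combination (ev Q η + ev H η) / 2 * this
  have hR : ∫ η : S2, sker z ‖ξ - η‖ * (n * ev Q η - (n + 2) * ev H η) ∂sig
      = n * sint ξ Q z - (n + 2) * sint ξ H z := by
    have h1 := sint_sub hξ (C (n : ℂ) * Q) (C ((n : ℂ) + 2) * H) z
    rw [sint_C_mul ξ n Q, sint_C_mul ξ (n + 2) H] at h1
    rw [← h1, sint]
    simp only [ev_sub, ev_mul, ev_C]
  rw [hL, hR, sint_add hξ, eint_add] at hsumI
  linear_combination -2 * hsumI

lemma besJ_zero (n : ℕ) : besJ n 0 = 0 := by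
  induction n with
  | zero => simp [besJ, bes]
  | succ n ih =>
    obtain ⟨d, _, h⟩ := (besJ_aux n 0).1
    rw [h, ih]; simp

/-- The eigenvalues of the single layer operator on spherical harmonics, multiplied by a power of
`z` that makes both sides entire in `z` and zero at `z = 0`; the step from degree `n` to `n + 1`
compares derivatives in `z`. -/
lemma sint_harm {ξ : E3} (hξ : ξ ∈ sphere (0 : E3) 1) (n : ℕ) {p : Poly} (hp : IsHarm n p)
    (z : ℂ) :
    z ^ (2 * n + 1) * sint ξ p z
      = 4 * Real.pi * Complex.I * ev p ξ * (besJ n z * besH n z) := by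
  induction n generalizing p z with
  | zero =>
    obtain ⟨c, rfl⟩ := IsHarm.exists_eq_C hp
    have h := integral_sker hξ z
    have h1 : sint ξ (C c) z = (∫ η : S2, sker z ‖ξ - η‖ ∂sig) * c := by
      simp only [sint, ev_C]
      exact integral_mul_const _ _
    simp only [h1, ev_C, besJ, besH, bes]
    field_simp
    linear_combination c * h
  | succ n ih =>
    have hn : (n + 1 : ℂ) ≠ 0 := by exact_mod_cast n.succ_ne_zero
    set Q : Poly := C (1 / (n + 1 : ℂ)) * dirP ξ p with hQ
    have hQh : IsHarm n Q := (hp.dirP ξ).C_mul _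
    have hQξ : ev Q ξ = ev p ξ := by
      rw [hQ, ev_mul, ev_C, ev_dirP_self hp]; push_cast; field_simp
    have ih' (w : ℂ) := ih hQh w
    rw [hQξ] at ih'
    set c : ℂ := 4 * Real.pi * Complex.I * ev p ξ with hc
    have hD (w : ℂ) : HasDerivAt (fun w => w ^ (2 * (n + 1) + 1) * sint ξ p w
        - c * (besJ (n + 1) w * besH (n + 1) w)) 0 w := by
      obtain ⟨⟨a, ha, ha'⟩, ha1⟩ := besJ_aux n w
      obtain ⟨⟨b, hb, hb'⟩, hb1⟩ := besH_aux n w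
      have d1 := ((hasDerivAt_pow (2 * n + 1) w).mul (hasDerivAt_sint hξ Q w)).unique
        (((ha.mul hb).const_mul c).congr_of_eventuallyEq (.of_forall ih'))
      have hrec := degree_recursion hξ hp w
      rw [← hQ] at hrec
      refine (((hasDerivAt_pow (2 * (n + 1) + 1) w).mul (hasDerivAt_sint hξ p w)).sub
        ((ha1.mul hb1).const_mul c)).congr_deriv ?_
      have i1 := ih' w
      rw [ha', hb']
      simp only [Nat.add_sub_cancel] at d1 ⊢
      push_cast at d1 ⊢
      have e1 : w ^ (2 * (n + 1)) = w ^ (2 * n) * w ^ 2 := by rw [← pow_add]; ring_nf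
      have e2 : w ^ (2 * (n + 1) + 1) = w ^ (2 * n) * w ^ 3 := by rw [← pow_add]; ring_nf
      have e3 : w ^ (2 * n + 1) = w ^ (2 * n) * w := pow_succ _ _
      rw [e3] at d1 i1
      rw [e1, e2]
      linear_combination w ^ (2 * n) * w ^ 2 * hrec + (4 * n + 2) * w * i1 - w ^ 2 * d1
    have hconst := is_const_of_deriv_eq_zero (fun w => (hD w).differentiableAt)
      (fun w => (hD w).deriv) z 0
    simp only [besJ_zero, zero_mul, mul_zero, sub_zero,
      zero_pow (Nat.succ_ne_zero (2 * (n + 1)))] at hconst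
    exact sub_eq_zero.1 hconst

/-- The eigenvalues of the single layer operator on spherical harmonics, in terms of `χ_n`. -/
lemma sint_eq {ξ : E3} (hξ : ξ ∈ sphere (0 : E3) 1) {n : ℕ} {p : Poly} (hp : IsHarm n p)
    {k : ℂ} {R : ℝ} (hR : R ≠ 0) (hk : k ≠ 0) :
    sint ξ p (k * R) = -4 * Real.pi * (chi n k R / R) * ev p ξ := by
  have hz : k * R ≠ 0 := mul_ne_zero hk (by exact_mod_cast hR)
  have hw := pow_ne_zero (2 * n + 1) hz
  have h := sint_harm hξ n hp (k * R)
  rw [chi_eq n hR hk]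
  field_simp
  linear_combination h

/-- The eigenvalues of the adjoint double layer operator on spherical harmonics: on the sphere,
its kernel is a multiple of `s F'(s) = i z e^{izs} - F(s)`. -/
lemma eint_eq {ξ : E3} (hξ : ξ ∈ sphere (0 : E3) 1) {n : ℕ} {p : Poly} (hp : IsHarm n p)
    {k : ℂ} {R : ℝ} (hR : R ≠ 0) (hk : k ≠ 0) :
    Complex.I * (k * R) * eint ξ p (k * R) - sint ξ p (k * R)
      = -8 * Real.pi * lam n k R * ev p ξ := by
  have hz : k * R ≠ 0 := mul_ne_zero hk (by exact_mod_cast hR)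
  rw [lam_eq n hR hk]
  generalize k * (R : ℂ) = w at *
  have hw := pow_ne_zero (2 * n) hz
  obtain ⟨⟨a, ha, ha'⟩, ha1⟩ := besJ_aux n w
  obtain ⟨⟨b, hb, hb'⟩, hb1⟩ := besH_aux n w
  have d1 := ((hasDerivAt_pow (2 * n + 1) w).mul (hasDerivAt_sint hξ p w)).unique
    (((ha.mul hb).const_mul _).congr_of_eventuallyEq (.of_forall (sint_harm hξ n hp)))
  have i1 := sint_harm hξ n hp w
  have hW := bes_wronskian n w
  simp only [Nat.add_sub_cancel] at d1
  push_cast at d1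
  have e3 : w ^ (2 * n + 1) = w ^ (2 * n) * w := pow_succ _ _
  rw [e3] at d1 i1 hW ⊢
  apply mul_left_cancel₀ (mul_ne_zero hw hz)
  rw [ha', hb'] at hW
  rw [ha']
  field_simp
  linear_combination 2 * w * d1 - (4 * n + 4) * i1 + 8 * Real.pi * Complex.I * ev p ξ * hW
    + 8 * Real.pi * ev p ξ * w ^ (2 * n) * w * Complex.I_sq

/-! ### The kernel of the magnetic dipole operator on the sphere of radius `R` -/

lemma cross_comp (a b : C3) (j : Fin 3) :
    crossProduct a b j = a (j + 1) * b (j + 2) - a (j + 2) * b (j + 1) := by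
  fin_cases j <;> simp [cross_apply]

/-- This holds at `x = y` too, where both sides are zero by the convention for division by zero. -/
lemma green_eq (k : ℂ) (x y : E3) :
    green k x y = -(1 / (4 * Real.pi)) * sker k √(‖x - y‖ ^ 2 + 0) := by
  rw [add_zero, Real.sqrt_sq (norm_nonneg _), green, sker]
  ring

lemma pd_green (k : ℂ) {x y : E3} (h : x ≠ y) :
    DifferentiableAt ℝ (fun z => green k z y) x ∧ ∀ i, pd i (fun z => green k z y) x
      = 1 / (4 * Real.pi) * dker k ‖x - y‖ * ((x i : ℂ) - y i) := by
  have hpos : 0 < ‖x - y‖ ^ 2 + 0 := by have := norm_sub_pos_of_ne h; positivity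
  simp only [green_eq]
  have hd := (hasFDerivAt_sker_dist k y hpos).differentiableAt
  refine ⟨hd.const_mul _, fun i => ?_⟩
  have h1 := pd_sker_dist k y hpos i
  rw [add_zero, Real.sqrt_sq (norm_nonneg _)] at h1
  have h2 : pd i (fun z => -(1 / (4 * Real.pi : ℂ)) * sker k √(‖z - y‖ ^ 2 + 0)) x
      = -(1 / (4 * Real.pi : ℂ)) * pd i (fun z => sker k √(‖z - y‖ ^ 2 + 0)) x := by
    simp only [pd]
    rw [fderiv_const_mul hd]
    simp
  rw [h2, h1]
  ring

lemma curl_green (k : ℂ) (c : C3) {x y : E3} (h : x ≠ y) :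
    curl (fun z => green k z y • c) x
      = (1 / (4 * Real.pi) * dker k ‖x - y‖) • crossProduct (cplx x - cplx y) c := by
  obtain ⟨hd, hp⟩ := pd_green k h
  have h1 (i a : Fin 3) : pd i (fun z => green k z y * c a) x
      = 1 / (4 * Real.pi) * dker k ‖x - y‖ * ((x i : ℂ) - y i) * c a := by
    rw [← hp i]
    simp only [pd]
    rw [fderiv_mul_const hd]
    simp
    ring
  ext j
  fin_cases j <;> simp [curl, h1, cross_apply, cplx] <;> ring

lemma dker_scale (k : ℂ) {R : ℝ} (s : ℝ) : dker k (R * s) = dker (k * R) s / R ^ 3 := by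
  simp only [dker]
  push_cast
  rw [show Complex.I * k * (R * s) = Complex.I * (k * R) * s by ring, mul_pow, div_div,
    mul_comm (_ ^ 3)]

lemma unitPt_smul {R : ℝ} (hR : 0 < R) {ξ : E3} (hξ : ξ ∈ sphere (0 : E3) 1) :
    unitPt (R • ξ) = ξ := by
  rw [unitPt, norm_smul, mem_sphere_zero_iff_norm.1 hξ, smul_smul, Real.norm_eq_abs, abs_of_pos hR]
  rw [mul_one, inv_mul_cancel₀ hR.ne', one_smul]

lemma normal_smul {R : ℝ} (hR : 0 < R) {ξ : E3} (hξ : ξ ∈ sphere (0 : E3) 1) :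
    normal (R • ξ) = cplx ξ := by
  ext i
  rw [normal, unitPt_smul hR hξ, cplx]

lemma dipoleIntegrand_eq (k : ℂ) {R : ℝ} (hR : 0 < R) (Φ : E3 → C3) {ξ η : E3}
    (hξ : ξ ∈ sphere (0 : E3) 1) (h : ξ ≠ η) :
    dipoleIntegrand k Φ (R • ξ) (R • η) = (1 / (4 * Real.pi * (R : ℂ) ^ 2)) •
      (dker (k * R) ‖ξ - η‖ •
        crossProduct (cplx ξ) (crossProduct (cplx ξ - cplx η) (Φ (R • η)))) := by
  have hR' : (R : ℂ) ≠ 0 := by exact_mod_cast hR.ne'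
  have hne : R • ξ ≠ R • η := fun h' => h (smul_right_injective E3 hR.ne' h')
  have hsub : cplx (R • ξ) - cplx (R • η) = (R : ℂ) • (cplx ξ - cplx η) := by
    ext i; simp [cplx]; ring
  rw [dipoleIntegrand, curl_green k _ hne, normal_smul hR hξ, ← smul_sub, norm_smul,
    Real.norm_eq_abs, abs_of_pos hR, dker_scale, hsub]
  simp only [map_smul, LinearMap.smul_apply, smul_smul]
  congr 1
  field_simp

/-! ### The surface measure of the sphere of radius `R` -/

lemma scale_embedding {R : ℝ} (hR : 0 < R) :
    MeasurableEmbedding (fun η : S2 => R • (η : E3)) := by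
  have hc : Continuous (fun η : S2 => R • (η : E3)) := by fun_prop
  refine (hc.isClosedEmbedding fun a b h => ?_).measurableEmbedding
  exact Subtype.ext (smul_right_injective E3 hR.ne' h)

lemma integrable_surf {F : Type*} [NormedAddCommGroup F] {R : ℝ} (hR : 0 < R)
    {f : E3 → F} (hf : Integrable (fun η : S2 => f (R • (η : E3))) sig) :
    Integrable f (surf R) :=
  (((scale_embedding hR).integrable_map_iff).2 hf).smul_measure ENNReal.ofReal_ne_top

lemma integral_surf {F : Type*} [NormedAddCommGroup F] [NormedSpace ℝ F] {R : ℝ} (hR : 0 < R)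
    (f : E3 → F) : ∫ y, f y ∂(surf R) = R ^ 2 • ∫ η : S2, f (R • (η : E3)) ∂sig := by
  rw [surf, integral_smul_measure, (scale_embedding hR).integral_map,
    ENNReal.toReal_ofReal (by positivity)]

lemma ae_surf_iff {R : ℝ} (hR : 0 < R) {p : E3 → Prop} :
    (∀ᵐ y ∂(surf R), p y) ↔ ∀ᵐ η : S2 ∂sig, p (R • (η : E3)) := by
  have h : ENNReal.ofReal (R ^ 2) ≠ 0 := by simpa using hR.ne'
  rw [surf, Measure.ae_ennreal_smul_measure_iff h, (scale_embedding hR).ae_map_iff]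

lemma memLp_surf {F : Type*} [NormedAddCommGroup F] {R : ℝ} (hR : 0 < R)
    {f : E3 → F} {g : E3 → F} (hg : Continuous g) (h : ∀ η : S2, f (R • (η : E3)) = g η) :
    MemLp f 2 (surf R) := by
  obtain ⟨M, hM⟩ := (isCompact_sphere (0 : E3) 1).exists_bound_of_continuousOn hg.continuousOn
  have h1 : MemLp (fun η : S2 => g η) 2 sig :=
    MemLp.of_bound (hg.comp continuous_subtype_val).aestronglyMeasurable_of_compactSpace M
      (.of_forall fun η => hM η η.2)
  have h2 : MemLp f 2 (sig.map (fun η : S2 => R • (η : E3))) := by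
    rw [(scale_embedding hR).memLp_map_measure_iff]
    exact h1.ae_eq (.of_forall fun η => (h η).symm)
  exact h2.smul_measure ENNReal.ofReal_ne_top

/-! ### The magnetic dipole operator on polynomial fields -/

/-- The vector field given by three polynomials. -/
noncomputable def vev (φ : Fin 3 → Poly) (y : E3) : C3 := fun i => ev (φ i) y

lemma continuous_vev (φ : Fin 3 → Poly) : Continuous (vev φ) :=
  continuous_pi fun i => continuous_ev (φ i)

/-- `ξ · φ` for a constant vector `ξ`. -/
noncomputable def cdot (ξ : E3) (φ : Fin 3 → Poly) : Poly := ∑ i, C (ξ i : ℂ) * φ i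

/-- The components of `ξ × φ` for a constant vector `ξ`. -/
noncomputable def ccross (ξ : E3) (φ : Fin 3 → Poly) (j : Fin 3) : Poly :=
  C (ξ (j + 1) : ℂ) * φ (j + 2) - C (ξ (j + 2) : ℂ) * φ (j + 1)

lemma ev_cdot (ξ : E3) (φ : Fin 3 → Poly) (y : E3) :
    ev (cdot ξ φ) y = ξ 0 * ev (φ 0) y + ξ 1 * ev (φ 1) y + ξ 2 * ev (φ 2) y := by
  simp [cdot, Fin.sum_univ_three]

lemma ev_ccross (ξ : E3) (φ : Fin 3 → Poly) (j : Fin 3) (y : E3) :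
    ev (ccross ξ φ j) y = ξ (j + 1) * ev (φ (j + 2)) y - ξ (j + 2) * ev (φ (j + 1)) y := by
  simp [ccross]

/-- Removing the strong singularity of `F'(s) / s` by the factor `1 - ξ · η = s ^ 2 / 2`. -/
lemma dker_mul_one_sub {ξ : E3} (hξ : ξ ∈ sphere (0 : E3) 1) (z : ℂ) (p : Poly) :
    Integrable (fun η : S2 => dker z ‖ξ - η‖ * ((1 - ev (dotP ξ) η) * ev p η)) sig ∧
    ∫ η : S2, dker z ‖ξ - η‖ * ((1 - ev (dotP ξ) η) * ev p η) ∂sig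
      = (sint ξ p z - Complex.I * z * eint ξ p z) / 2 := by
  have hae : (fun η : S2 => (sker z ‖ξ - η‖ * ev p η - Complex.I * z *
      (Complex.exp (Complex.I * z * (‖ξ - η‖ : ℝ)) * ev p η)) / 2)
      =ᵐ[sig] fun η : S2 => dker z ‖ξ - η‖ * ((1 - ev (dotP ξ) η) * ev p η) := by
    filter_upwards [ae_ne hξ] with η hη
    have := dker_mul_sq z (norm_sub_pos_of_ne hη).ne'
    rw [one_sub_dotP hξ η.2]
    linear_combination -ev p η / 2 * this
  have i1 := integrable_sker_mul hξ z (continuous_ev p)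
  have i2 := (integrable_exp_mul ξ p z).const_mul (Complex.I * z)
  refine ⟨((i1.sub i2).div_const 2).congr hae, ?_⟩
  rw [← integral_congr_ae hae, integral_div, integral_sub i1 i2, integral_const_mul]
  rfl

/-- One component of `ξ × ((ξ - η) × φ) = -ξ × (ξ × (ξ × ((ξ - η) × φ)))` for `|ξ| = 1`. -/
lemma cross_cross_sub (x0 x1 x2 y0 y1 y2 p0 p1 p2 : ℂ) (h : x0 ^ 2 + x1 ^ 2 + x2 ^ 2 = 1) :
    x1 * ((x0 - y0) * p1 - (x1 - y1) * p0) - x2 * ((x2 - y2) * p0 - (x0 - y0) * p2)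
      = x2 * ((y2 * x0 - y0 * x2) * (x0 * p0 + x1 * p1 + x2 * p2)
          - (1 - (x0 * y0 + x1 * y1 + x2 * y2)) * (x2 * p0 - x0 * p2))
        - x1 * ((y0 * x1 - y1 * x0) * (x0 * p0 + x1 * p1 + x2 * p2)
          - (1 - (x0 * y0 + x1 * y1 + x2 * y2)) * (x0 * p1 - x1 * p0)) := by
  linear_combination -(x1 * ((x0 - y0) * p1 - (x1 - y1) * p0)
    - x2 * ((x2 - y2) * p0 - (x0 - y0) * p2)
    - (x1 * (x0 * p1 - x1 * p0) - x2 * (x2 * p0 - x0 * p2))) * h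

/-- The magnetic dipole operator on a polynomial field `φ`, tangential at `ξ`. Up to the factor
`1 / (4πR²)`, applying `ξ ×` to the integrand gives
`-F'(s) / s ((η × ξ) (ξ · φ) - (1 - ξ · η) ξ × φ)`: the first part is integrated by parts, the
second is weakly singular. -/
lemma dipole_of_polynomial {R : ℝ} (hR : 0 < R) (k m : ℂ) {ξ : E3} (hξ : ξ ∈ sphere (0 : E3) 1)
    (φ : Fin 3 → Poly) (hφ : ev (cdot ξ φ) ξ = 0) (Φ : E3 → C3)
    (hΦ : ∀ η : S2, Φ (R • (η : E3)) = vev φ η)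
    (hm : ∀ j, -sint ξ (rot j (cdot ξ φ)) (k * R) - (sint ξ (ccross ξ φ j) (k * R)
      - Complex.I * (k * R) * eint ξ (ccross ξ φ j) (k * R)) / 2
      = 4 * Real.pi * m * ev (ccross ξ φ j) ξ) :
    Integrable (dipoleIntegrand k Φ (R • ξ)) (surf R) ∧
      dipoleOp R k Φ (R • ξ) = m • Φ (R • ξ) := by
  have hR' : (R : ℂ) ≠ 0 := by exact_mod_cast hR.ne'
  have hξ1 := sq_sum_coord hξ
  have hq0 (j : Fin 3) : ev (rot j (dotP ξ)) ξ = 0 := by rw [ev_rot_dotP]; ring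
  -- `v` is `ξ ×` the integrand, and `w = -ξ × v` recovers the integrand, which is normal to `ξ`
  let v : Fin 3 → S2 → ℂ := fun j η => dker (k * R) ‖ξ - η‖ *
    (ev (rot j (dotP ξ)) η * ev (cdot ξ φ) η)
    - dker (k * R) ‖ξ - η‖ * ((1 - ev (dotP ξ) η) * ev (ccross ξ φ j) η)
  have hv (j : Fin 3) : Integrable (v j) sig :=
    (integrable_dker_mul hξ _ _ _ (hq0 j) hφ).sub (dker_mul_one_sub hξ _ _).1
  have hvI (j : Fin 3) : ∫ η, v j η ∂sig = 4 * Real.pi * m * ev (ccross ξ φ j) ξ := by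
    rw [integral_sub (integrable_dker_mul hξ _ _ _ (hq0 j) hφ) (dker_mul_one_sub hξ _ _).1,
      integral_dker_mul_rot hξ _ j _ hφ, (dker_mul_one_sub hξ _ _).2, ← hm j]
    rfl
  let w : Fin 3 → S2 → ℂ := fun i η => 1 / (4 * Real.pi * (R : ℂ) ^ 2) *
    (ξ (i + 2) * v (i + 1) η - ξ (i + 1) * v (i + 2) η)
  have hw (i : Fin 3) : Integrable (w i) sig :=
    (((hv _).const_mul _).sub ((hv _).const_mul _)).const_mul _
  have hwI (i : Fin 3) : ∫ η, w i η ∂sig = m / (R : ℂ) ^ 2 * ev (φ i) ξ := by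
    have hφ' := hφ
    rw [ev_cdot] at hφ'
    rw [integral_const_mul, integral_sub ((hv _).const_mul _) ((hv _).const_mul _),
      integral_const_mul, integral_const_mul, hvI, hvI]
    have hpi : (Real.pi : ℂ) ≠ 0 := by exact_mod_cast Real.pi_ne_zero
    have hcross : ξ (i + 2) * ev (ccross ξ φ (i + 1)) ξ - ξ (i + 1) * ev (ccross ξ φ (i + 2)) ξ
        = ev (φ i) ξ := by
      simp only [ev_ccross]
      fin_cases i <;> simp
      · linear_combination ev (φ 0) ξ * hξ1 - ξ 0 * hφ'
      · linear_combination ev (φ 1) ξ * hξ1 - ξ 1 * hφ'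
      · linear_combination ev (φ 2) ξ * hξ1 - ξ 2 * hφ'
    rw [← hcross]
    field_simp
  have hae : (fun η : S2 => dipoleIntegrand k Φ (R • ξ) (R • (η : E3)))
      =ᵐ[sig] fun η i => w i η := by
    filter_upwards [ae_ne hξ] with η hη
    rw [dipoleIntegrand_eq k hR Φ hξ hη, hΦ]
    ext i
    have key := fun i : Fin 3 => cross_cross_sub (ξ i) (ξ (i + 1)) (ξ (i + 2)) (η.1 i)
      (η.1 (i + 1)) (η.1 (i + 2)) (ev (φ i) η) (ev (φ (i + 1)) η) (ev (φ (i + 2)) η)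
    simp only [Pi.smul_apply, smul_eq_mul, cross_comp, w, v, ev_rot_dotP, ev_cdot, ev_ccross,
      ev_dotP, vev, Pi.sub_apply, cplx]
    fin_cases i
    · have key0 := key 0 hξ1
      simp only [Fin.isValue, Fin.reduceAdd, Fin.zero_eta] at key0 ⊢
      linear_combination 1 / (4 * Real.pi * (R : ℂ) ^ 2) * dker (k * R) ‖ξ - η‖ * key0
    · have key1 := key 1 (by simp; linear_combination hξ1)
      simp only [Fin.isValue, Fin.reduceAdd, Fin.mk_one] at key1 ⊢
      linear_combination 1 / (4 * Real.pi * (R : ℂ) ^ 2) * dker (k * R) ‖ξ - η‖ * key1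
    · have key2 := key 2 (by simp; linear_combination hξ1)
      simp only [Fin.isValue, Fin.reduceAdd, Fin.reduceFinMk] at key2 ⊢
      linear_combination 1 / (4 * Real.pi * (R : ℂ) ^ 2) * dker (k * R) ‖ξ - η‖ * key2
  have hint : Integrable (fun η : S2 => dipoleIntegrand k Φ (R • ξ) (R • (η : E3))) sig :=
    (Integrable.of_eval hw).congr hae.symm
  refine ⟨integrable_surf hR hint, ?_⟩
  rw [dipoleOp, integral_surf hR, integral_congr_ae hae]
  ext i
  rw [Pi.smul_apply, eval_integral hw, hwI, hΦ ⟨ξ, hξ⟩]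
  simp [vev]
  field_simp

/-! ### The eigenvalue identities for the two polynomial fields -/

lemma ev_cross_self (ξ : E3) (p : Poly) (j : Fin 3) :
    (ξ (j + 1) : ℂ) * ev (rot (j + 2) p) ξ - ξ (j + 2) * ev (rot (j + 1) p) ξ
      = ξ j * (ξ 0 * ev (pderiv 0 p) ξ + ξ 1 * ev (pderiv 1 p) ξ + ξ 2 * ev (pderiv 2 p) ξ)
        - (ξ 0 ^ 2 + ξ 1 ^ 2 + ξ 2 ^ 2) * ev (pderiv j p) ξ := by
  fin_cases j <;> simp [rot] <;> ring

/-- The field `∇P × η = -(η × ∇)P`, with harmonic components of the same degree as `P`. -/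
noncomputable def curlField (p : Poly) : Fin 3 → Poly := fun j => -rot j p

lemma ev_cdot_curlField (p : Poly) (ξ : E3) : ev (cdot ξ (curlField p)) ξ = 0 := by
  simp only [ev_cdot, curlField, ev_neg, rot, ev_sub, ev_mul, ev_X, Fin.isValue, Fin.reduceAdd]
  ring

lemma IsHarm.neg {n : ℕ} {p : Poly} (hp : IsHarm n p) : IsHarm n (-p) := by
  have := (isHarm_zero n).sub hp
  rwa [zero_sub] at this

lemma IsHarm.cdot {n : ℕ} {φ : Fin 3 → Poly} (h : ∀ i, IsHarm n (φ i)) (ξ : E3) :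
    IsHarm n (cdot ξ φ) := by
  rw [MaxwellBall.cdot, Fin.sum_univ_three]
  exact (((h 0).C_mul _).add ((h 1).C_mul _)).add ((h 2).C_mul _)

lemma IsHarm.ccross {n : ℕ} {φ : Fin 3 → Poly} (h : ∀ i, IsHarm n (φ i)) (ξ : E3) (j : Fin 3) :
    IsHarm n (ccross ξ φ j) :=
  ((h _).C_mul _).sub ((h _).C_mul _)

lemma ev_rot_cdot_curlField (p : Poly) (ξ : E3) (j : Fin 3) :
    ev (rot j (cdot ξ (curlField p))) ξ = -ev (ccross ξ (curlField p) j) ξ := by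
  rw [ev_ccross]
  simp only [cdot, curlField, Fin.sum_univ_three, rot, map_add, map_neg, map_sub,
    Derivation.leibniz, smul_eq_mul, MvPolynomial.pderiv_C]
  fin_cases j <;> simp [MvPolynomial.pderiv_X] <;> ring

lemma curlField_eigen {n : ℕ} (hn : 1 ≤ n) {p : Poly} (hp : IsHarm n p) {R : ℝ} (hR : R ≠ 0)
    {k : ℂ} (hk : k ≠ 0) {ξ : E3} (hξ : ξ ∈ sphere (0 : E3) 1) (j : Fin 3) :
    -sint ξ (rot j (cdot ξ (curlField p))) (k * R) - (sint ξ (ccross ξ (curlField p) j) (k * R)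
      - Complex.I * (k * R) * eint ξ (ccross ξ (curlField p) j) (k * R)) / 2
      = 4 * Real.pi * m1 n k R * ev (ccross ξ (curlField p) j) ξ := by
  have hφ (i : Fin 3) : IsHarm n (curlField p i) := (hp.rot i).neg
  have h1 := sint_eq hξ ((IsHarm.cdot hφ ξ).rot j) hR hk
  have h2 := eint_eq hξ (IsHarm.ccross hφ ξ j) hR hk
  rw [ev_rot_cdot_curlField] at h1
  rw [m1_eq_neg_m2 n hn hR hk, m2]
  linear_combination -h1 + h2 / 2

/-- The square of the Euclidean norm. -/
noncomputable def normSqP : Poly := X 0 ^ 2 + X 1 ^ 2 + X 2 ^ 2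

/-- The harmonic component of degree `n + 1` of `X_i P`, for `P` harmonic of degree `n`. -/
noncomputable def raise (n : ℕ) (p : Poly) (i : Fin 3) : Poly :=
  X i * p - C (1 / (2 * n + 1 : ℂ)) * (normSqP * pderiv i p)

lemma lap_normSqP_mul {n : ℕ} {p : Poly} (hp : IsHarm n p) (i : Fin 3) :
    lap (normSqP * pderiv i p) = (4 * (n : Poly) + 2) * pderiv i p := by
  have e := euler_pderiv hp.1 i
  have hl : lap (pderiv i p) = 0 := (hp.pderiv i).2
  have h1 (a : Fin 3) (q : Poly) (hq : lap q = 0) :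
      lap (X a ^ 2 * q) = 2 * q + 4 * X a * pderiv a q := by
    rw [pow_two, mul_assoc, lap_X_mul, lap_X_mul, hq]
    simp [Derivation.leibniz]
    ring
  rw [normSqP, add_mul, add_mul, lap_add, lap_add, h1 _ _ hl, h1 _ _ hl, h1 _ _ hl]
  linear_combination 4 * e

lemma raise_isHarm {n : ℕ} (hn : 1 ≤ n) {p : Poly} (hp : IsHarm n p) (i : Fin 3) :
    IsHarm (n + 1) (raise n p i) := by
  refine ⟨?_, ?_⟩
  · have h1 : (X i * p : Poly).IsHomogeneous (n + 1) := by
      rw [add_comm]; exact (MvPolynomial.isHomogeneous_X ℂ i).mul hp.1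
    have h2 : (normSqP : Poly).IsHomogeneous 2 :=
      (((MvPolynomial.isHomogeneous_X ℂ 0).pow 2).add
        ((MvPolynomial.isHomogeneous_X ℂ 1).pow 2)).add ((MvPolynomial.isHomogeneous_X ℂ 2).pow 2)
    have h3 := h2.mul (hp.1.pderiv (i := i))
    rw [show 2 + (n - 1) = n + 1 by omega] at h3
    exact h1.sub (h3.C_mul _)
  · have hn2 := two_mul_add_one_ne n
    have hc : (C (1 / (2 * n + 1 : ℂ)) : Poly) * (4 * (n : Poly) + 2) = 2 := by
      have : (4 * (n : Poly) + 2) = C (4 * n + 2 : ℂ) := by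
        simp only [map_add, map_mul, map_natCast, map_ofNat]
      rw [this, ← map_mul, show 1 / (2 * n + 1 : ℂ) * (4 * n + 2) = 2 by field_simp; ring]
      exact map_ofNat C 2
    rw [raise, lap_sub, lap_X_mul, lap_C_mul, lap_normSqP_mul hp, hp.2]
    linear_combination -pderiv i p * hc

/-- The field that agrees on the unit sphere with the surface gradient `∇P - n P η`, split into
harmonic components of degrees `n - 1` and `n + 1`. -/
noncomputable def gradField (n : ℕ) (p : Poly) : Fin 3 → Poly := fun i =>
  C ((n + 1) / (2 * n + 1 : ℂ)) * pderiv i p - C (n : ℂ) * raise n p i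

lemma ev_normSqP {η : E3} (hη : η ∈ sphere (0 : E3) 1) : ev normSqP η = 1 := by
  simpa [normSqP] using sq_sum_coord hη

lemma ev_raise (n : ℕ) (p : Poly) (i : Fin 3) {η : E3} (hη : η ∈ sphere (0 : E3) 1) :
    ev (raise n p i) η = η i * ev p η - 1 / (2 * n + 1) * ev (pderiv i p) η := by
  simp [raise, ev_normSqP hη]

lemma ev_gradField (n : ℕ) (p : Poly) (i : Fin 3) {η : E3} (hη : η ∈ sphere (0 : E3) 1) :
    ev (gradField n p i) η = ev (pderiv i p) η - n * ev p η * η i := by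
  have hn2 := mul_inv_cancel₀ (two_mul_add_one_ne n)
  rw [gradField, ev_sub, ev_mul, ev_mul, ev_raise n p i hη, ev_C, ev_C]
  linear_combination ev (pderiv i p) η * hn2

lemma ev_cdot_gradField {n : ℕ} {p : Poly} (hp : IsHarm n p) {ξ : E3}
    (hξ : ξ ∈ sphere (0 : E3) 1) : ev (cdot ξ (gradField n p)) ξ = 0 := by
  have h1 := ev_euler hp.1 ξ
  have h2 := sq_sum_coord hξ
  simp only [ev_cdot, ev_gradField n p _ hξ]
  linear_combination h1 - n * ev p ξ * h2

lemma ev_rot_eq (j : Fin 3) (p : Poly) (ξ : E3) : ev (rot j p) ξ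
    = ξ (j + 1) * ev (pderiv (j + 2) p) ξ - ξ (j + 2) * ev (pderiv (j + 1) p) ξ := by
  simp [rot]

lemma ev_ccross_gradField (n : ℕ) (p : Poly) {ξ : E3}
    (hξ : ξ ∈ sphere (0 : E3) 1) (j : Fin 3) :
    ev (ccross ξ (gradField n p) j) ξ = ev (rot j p) ξ := by
  rw [ev_ccross, ev_gradField n p _ hξ, ev_gradField n p _ hξ, ev_rot_eq]
  ring

lemma ev_rot_dirP {n : ℕ} {p : Poly} (hp : IsHarm n p) (ξ : E3) (j : Fin 3) :
    ev (rot j (dirP ξ p)) ξ = (n - 1) * ev (rot j p) ξ := by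
  have e (i : Fin 3) := congrArg (fun q => ev q ξ) (euler_pderiv hp.1 i)
  have hd (i : Fin 3) : ev (pderiv i (dirP ξ p)) ξ = (n - 1) * ev (pderiv i p) ξ := by
    have h := e i
    simp only [ev_add, ev_mul, ev_X, ev_sub, ev_natCast, ev_one] at h
    rw [← h]
    simp only [dirP, Fin.sum_univ_three, map_add, pderiv_C_mul', ev_add, ev_mul, ev_C,
      pderiv_comm i]
  rw [ev_rot_eq, ev_rot_eq, hd, hd]
  ring

lemma rot_normSqP (j : Fin 3) : rot j normSqP = 0 := by
  fin_cases j <;> simp [rot, normSqP, MvPolynomial.pderiv_X] <;> ring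

lemma ev_rot_cdot_raise {n : ℕ} {p : Poly} (hp : IsHarm n p) {ξ : E3}
    (hξ : ξ ∈ sphere (0 : E3) 1) (j : Fin 3) :
    ev (rot j (cdot ξ (raise n p))) ξ = (n + 2) / (2 * n + 1) * ev (rot j p) ξ := by
  have hn2 := two_mul_add_one_ne n
  have h1 : cdot ξ (raise n p)
      = dotP ξ * p - C (1 / (2 * n + 1 : ℂ)) * (normSqP * dirP ξ p) := by
    simp only [cdot, raise, dotP, dirP, Fin.sum_univ_three]
    ring
  have h2 : ev (rot j (dotP ξ)) ξ = 0 := by rw [ev_rot_dotP]; ring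
  rw [h1, rot_sub, rot_mul, rot_C_mul, rot_mul, rot_normSqP]
  simp only [ev_sub, ev_add, ev_mul, ev_C, ev_zero, h2, ev_dotP_self hξ, ev_normSqP hξ,
    ev_rot_dirP hp]
  field_simp
  ring

lemma gradField_eigen {n : ℕ} (hn : 1 ≤ n) {p : Poly} (hp : IsHarm n p) {R : ℝ} (hR : R ≠ 0)
    {k : ℂ} (hk : k ≠ 0) {ξ : E3} (hξ : ξ ∈ sphere (0 : E3) 1) (j : Fin 3) :
    -sint ξ (rot j (cdot ξ (gradField n p))) (k * R)
      - (sint ξ (ccross ξ (gradField n p) j) (k * R)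
        - Complex.I * (k * R) * eint ξ (ccross ξ (gradField n p) j) (k * R)) / 2
      = 4 * Real.pi * m2 n k R * ev (ccross ξ (gradField n p) j) ξ := by
  have hR' : (R : ℂ) ≠ 0 := by exact_mod_cast hR
  have hn2 := two_mul_add_one_ne n
  have hd (i : Fin 3) : IsHarm (n - 1) (pderiv i p) := hp.pderiv i
  have hr (i : Fin 3) : IsHarm (n + 1) (raise n p i) := raise_isHarm hn hp i
  have e1 : rot j (cdot ξ (gradField n p)) = C ((n + 1) / (2 * n + 1 : ℂ)) * rot j (dirP ξ p)
      - C (n : ℂ) * rot j (cdot ξ (raise n p)) := by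
    have h : cdot ξ (gradField n p)
        = C ((n + 1) / (2 * n + 1 : ℂ)) * dirP ξ p - C (n : ℂ) * cdot ξ (raise n p) := by
      simp only [cdot, gradField, dirP, Fin.sum_univ_three]
      ring
    rw [h, rot_sub, rot_C_mul, rot_C_mul]
  have e2 : ccross ξ (gradField n p) j
      = C ((n + 1) / (2 * n + 1 : ℂ)) * ccross ξ (fun i => pderiv i p) j
        - C (n : ℂ) * ccross ξ (raise n p) j := by
    simp only [ccross, gradField]
    ring
  have v1 : ev (ccross ξ (fun i => pderiv i p) j) ξ = ev (rot j p) ξ := by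
    rw [ev_ccross, ev_rot_eq]
  have v2 : ev (ccross ξ (raise n p) j) ξ = -(1 / (2 * n + 1)) * ev (rot j p) ξ := by
    rw [ev_ccross, ev_raise n p _ hξ, ev_raise n p _ hξ, ev_rot_eq]
    ring
  have a1 := sint_eq hξ ((hp.dirP ξ).rot j) hR hk
  have a2 := sint_eq hξ ((IsHarm.cdot hr ξ).rot j) hR hk
  have b1 := eint_eq hξ (IsHarm.ccross hd ξ j) hR hk
  have b2 := eint_eq hξ (IsHarm.ccross hr ξ j) hR hk
  rw [ev_rot_dirP hp] at a1
  rw [ev_rot_cdot_raise hp hξ] at a2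
  rw [v1] at b1
  rw [v2] at b2
  have hm : m2 n k R = -m1 n k R := by rw [m1_eq_neg_m2 n hn hR hk, neg_neg]
  rw [ev_ccross_gradField n p hξ, e1, e2, sint_sub hξ, sint_sub hξ, eint_sub, sint_C_mul,
    sint_C_mul, sint_C_mul, sint_C_mul, eint_C_mul, eint_C_mul, hm, m1, pi1, sigma1, sigma3]
  linear_combination (-((n + 1) / (2 * n + 1 : ℂ))) * a1 + n * a2
    + ((n + 1) / (2 * n + 1 : ℂ)) / 2 * b1 - n / 2 * b2

/-! ### The fields `∇_𝕊 Y` and `∇_𝕊 Y × ν` -/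

lemma hasFDerivAt_unitPt {η : E3} (hη : η ∈ sphere (0 : E3) 1) :
    HasFDerivAt unitPt (ContinuousLinearMap.id ℝ E3 - (innerSL ℝ η).smulRight η) η := by
  have hn : ‖η‖ = 1 := mem_sphere_zero_iff_norm.1 hη
  have h0 : (fun z : E3 => unitPt z) = fun z => (√(‖z‖ ^ 2))⁻¹ • z := by
    funext z; rw [unitPt, Real.sqrt_sq (norm_nonneg _)]
  have h1 := ((hasFDerivAt_id η).norm_sq).sqrt (by simp [hn])
  have h2 := ((hasDerivAt_inv (by simp [hn] : √(‖id η‖ ^ 2) ≠ 0)).comp_hasFDerivAt η h1).smul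
    (hasFDerivAt_id η)
  change HasFDerivAt (fun z : E3 => unitPt z) _ η
  rw [h0]
  refine h2.congr_fderiv ?_
  ext v : 1
  simp [hn]
  module

lemma sphereGrad_eq {n : ℕ} {p : Poly} (hp : IsHarm n p) {Y : E3 → ℂ}
    (hY : ∀ ξ ∈ sphere (0 : E3) 1, Y ξ = ev p ξ) {R : ℝ} (hR : 0 < R) {η : E3}
    (hη : η ∈ sphere (0 : E3) 1) :
    sphereGrad Y (R • η) = vev (gradField n p) η := by
  have hη0 : η ≠ 0 := by rintro rfl; simp at hη
  have hu : unitPt η = η := by simpa using unitPt_smul one_pos hη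
  have he : (fun z => Y (unitPt z)) =ᶠ[nhds η] fun z => ev p (unitPt z) := by
    filter_upwards [isOpen_ne.mem_nhds hη0] with z hz
    apply hY
    rw [mem_sphere_zero_iff_norm, unitPt, norm_smul, norm_inv, norm_norm,
      inv_mul_cancel₀ (norm_ne_zero_iff.2 hz)]
  have hd : HasFDerivAt (ev p) (fderiv ℝ (ev p) η) (unitPt η) := by
    rw [hu]; exact (differentiable_ev p η).hasFDerivAt
  have hc := hd.comp η (hasFDerivAt_unitPt hη)
  have hself : fderiv ℝ (ev p) η η = n * ev p η := by
    have h1 : η = ∑ i, η i • EuclideanSpace.single i (1 : ℝ) := by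
      ext i
      fin_cases i <;> simp [Fin.sum_univ_three]
    have h2 (i : Fin 3) : fderiv ℝ (ev p) η (EuclideanSpace.single i 1) = ev (pderiv i p) η :=
      pd_ev i p η
    have h3 : fderiv ℝ (ev p) η η
        = fderiv ℝ (ev p) η (∑ i, η i • EuclideanSpace.single i (1 : ℝ)) := by rw [← h1]
    rw [h3, ← ev_euler hp.1, Fin.sum_univ_three]
    simp only [map_add, map_smul, h2, Complex.real_smul]
  ext i
  rw [sphereGrad, unitPt_smul hR hη, vev, ev_gradField n p i hη, ← pd_ev]
  simp only [grad, pd]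
  rw [he.fderiv_eq]
  have hc' : fderiv ℝ (fun z => ev p (unitPt z)) η = _ := hc.fderiv
  rw [hc']
  simp [EuclideanSpace.inner_single_right, hself]
  ring

lemma sphereCurl_eq {n : ℕ} {p : Poly} (hp : IsHarm n p) {Y : E3 → ℂ}
    (hY : ∀ ξ ∈ sphere (0 : E3) 1, Y ξ = ev p ξ) {R : ℝ} (hR : 0 < R) {η : E3}
    (hη : η ∈ sphere (0 : E3) 1) :
    sphereCurl Y (R • η) = vev (curlField p) η := by
  rw [sphereCurl, sphereGrad_eq hp hY hR hη, normal_smul hR hη]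
  ext j
  simp only [cross_comp, vev, ev_gradField n p _ hη, cplx, curlField, ev_neg, ev_rot_eq]
  ring

/-- A field `W × η` with `W` polynomial belongs to `TH(div)`; its surface divergence is
`∑ L_j W_j / R`. -/
lemma memTHdiv_cross {R : ℝ} (hR : 0 < R) {Φ : E3 → C3} (φ W : Fin 3 → Poly)
    (hΦ : ∀ η : S2, Φ (R • (η : E3)) = vev φ η)
    (hW : ∀ η : S2, vev φ η = crossProduct (vev W η) (cplx η)) : MemTHdiv R Φ := by
  have hR' : (R : ℂ) ≠ 0 := by exact_mod_cast hR.ne'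
  let D : Poly := ∑ j, rot j (W j)
  have hg (η : S2) : ev D (unitPt (R • (η : E3))) / R = ev D η / R := by rw [unitPt_smul hR η.2]
  refine ⟨memLp_surf hR (continuous_vev φ) hΦ, ?_, fun y => ev D (unitPt y) / R,
    memLp_surf hR ((continuous_ev D).div_const _) hg, ?_⟩
  · rw [ae_surf_iff hR]
    refine .of_forall fun η => ?_
    rw [normal_smul hR η.2, hΦ, hW]
    simp only [dotProduct, cross_comp, Fin.sum_univ_three, Fin.isValue, Fin.reduceAdd]
    ring
  · intro ψ hψ
    rw [integral_surf hR, integral_surf hR, ← smul_neg]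
    congr 1
    have hψ1 : ContDiff ℝ 1 (fun η : E3 => ψ (R • η)) :=
      (hψ.of_le (by simp)).comp (contDiff_const_smul R)
    have hpd (i : Fin 3) (η : E3) : pd i (fun η : E3 => ψ (R • η)) η = R * pd i ψ (R • η) := by
      have h1 : HasFDerivAt ψ (fderiv ℝ ψ (R • η)) (R • η) :=
        (hψ.differentiable (by simp) _).hasFDerivAt
      have h2 := h1.comp η ((hasFDerivAt_id η).const_smul R)
      have h3 : fderiv ℝ (fun η : E3 => ψ (R • η)) η = _ := h2.fderiv
      simp only [pd]
      rw [h3]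
      simp
    have hL (j : Fin 3) : ∫ η : S2, angDeriv j (fun z => ev (W j) z * ψ (R • z)) η ∂sig = 0 :=
      integral_angDeriv (((contDiff_ev (W j)).of_le (by simp)).mul hψ1) j
    have hc (j : Fin 3) : Integrable
        (fun η : S2 => angDeriv j (fun z => ev (W j) z * ψ (R • z)) η) sig :=
      integrable_sphere (continuous_angDeriv (((contDiff_ev (W j)).of_le (by simp)).mul hψ1) j)
    have hsum : ∫ η : S2, ∑ j, angDeriv j (fun z => ev (W j) z * ψ (R • z)) η ∂sig = 0 := by
      rw [integral_finsetSum _ fun j _ => hc j]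
      simp [hL]
    have hpt (η : S2) : ∑ j, angDeriv j (fun z => ev (W j) z * ψ (R • z)) η
        = R * (ev D η / R * ψ (R • (η : E3)) + Φ (R • (η : E3)) ⬝ᵥ grad ψ (R • (η : E3))) := by
      have h1 (j : Fin 3) : angDeriv j (fun z => ev (W j) z * ψ (R • z)) η
          = ev (rot j (W j)) η * ψ (R • (η : E3))
            + ev (W j) η * angDeriv j (fun z => ψ (R • z)) η := by
        rw [angDeriv_mul (differentiable_ev _ _) (hψ1.differentiable (by simp) _), angDeriv_ev]
      rw [Finset.sum_congr rfl fun j _ => h1 j, hΦ, hW]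
      simp only [D, ev_add, dotProduct, cross_comp, Fin.sum_univ_three, grad,
        angDeriv, hpd, vev, cplx, Fin.isValue, Fin.reduceAdd]
      field_simp
      ring
    have hψc : Continuous fun η : E3 => ψ (R • η) := hψ1.continuous
    have i1 : Integrable (fun η : S2 => ev D η / R * ψ (R • (η : E3))) sig :=
      integrable_sphere (((continuous_ev D).div_const _).mul hψc)
    have i2 : Integrable (fun η : S2 => Φ (R • (η : E3)) ⬝ᵥ grad ψ (R • (η : E3))) sig := by
      have hs : Integrable (fun η : S2 => ∑ j, angDeriv j (fun z => ev (W j) z * ψ (R • z)) η)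
          sig := integrable_finsetSum _ fun j _ => hc j
      refine ((hs.div_const (R : ℂ)).sub i1).congr (.of_forall fun η => ?_)
      simp only [Pi.sub_apply]
      rw [hpt]
      field_simp
      ring
    simp only [hpt] at hsum
    rw [integral_const_mul, integral_add i1 i2] at hsum
    have h0 := (mul_eq_zero.1 hsum).resolve_left hR'
    simp only [hg]
    exact eq_neg_of_add_eq_zero_left h0

lemma curlField_cross (p : Poly) (η : S2) :
    vev (curlField p) η = crossProduct (vev (fun i => pderiv i p) η) (cplx η) := by
  ext j
  simp only [cross_comp, vev, cplx, curlField, ev_neg, ev_rot_eq]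
  ring

lemma gradField_cross {n : ℕ} {p : Poly} (hp : IsHarm n p) (η : S2) :
    vev (gradField n p) η = crossProduct (vev (fun i => rot i p) η) (cplx η) := by
  have h1 := ev_euler hp.1 (η : E3)
  have h2 := sq_sum_coord η.2
  ext j
  have h3 := ev_cross_self (η : E3) p j
  simp only [cross_comp, vev, cplx, ev_gradField n p j η.2]
  rw [h1, h2] at h3
  linear_combination h3

/-- A spherical harmonic of positive degree with vanishing angular derivatives is zero. -/
lemma ev_eq_zero_of_rot_eq_zero {n : ℕ} (hn : 1 ≤ n) {p : Poly} (hp : IsHarm n p)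
    (h : ∀ j, ∀ η ∈ sphere (0 : E3) 1, ev (rot j p) η = 0) {η : E3}
    (hη : η ∈ sphere (0 : E3) 1) : ev p η = 0 := by
  have h2 (j : Fin 3) : ev (rot j (rot j p)) η = 0 := by
    have hd := hasDerivAt_comp_rotate ((contDiff_ev (rot j p)).of_le (by simp)) j 0 η
    have h0 : (fun t => ev (rot j p) (rotate j t η)) = fun _ => 0 := by
      funext t
      apply h
      rw [mem_sphere_zero_iff_norm, norm_rotate, mem_sphere_zero_iff_norm.1 hη]
    rw [h0, angDeriv_ev, show rotate j 0 η = η by simp [rotate]] at hd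
    exact hd.unique (hasDerivAt_const _ _)
  have h3 := congrArg (fun q => ev q η) (sum_rot_rot hp)
  simp only [ev_sum, h2, Finset.sum_const_zero, ev_mul, ev_neg, ev_natCast, ev_add, ev_one] at h3
  have h4 : ((n : ℂ) * (n + 1)) ≠ 0 := by exact_mod_cast (by positivity : n * (n + 1) ≠ 0)
  have h5 : ((n : ℂ) * (n + 1)) * ev p η = 0 := by linear_combination h3
  exact (mul_eq_zero.1 h5).resolve_left h4

lemma vev_eq_zero {R : ℝ} (hR : 0 < R) {Φ : E3 → C3} {φ : Fin 3 → Poly}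
    (hΦ : ∀ η : S2, Φ (R • (η : E3)) = vev φ η) (h : Φ =ᵐ[surf R] 0) (η : S2) :
    vev φ η = 0 := by
  have h1 : ∀ᵐ η : S2 ∂sig, Φ (R • (η : E3)) = 0 := (ae_surf_iff hR).1 h
  have h2 : (fun η : S2 => vev φ η) =ᵐ[sig] fun _ => 0 := by
    filter_upwards [h1] with η hη
    rw [← hΦ, hη]
  have h3 := (Continuous.ae_eq_iff_eq sig ((continuous_vev φ).comp continuous_subtype_val)
    continuous_const).1 h2
  exact congrFun h3 η

lemma exists_smul_eq {R : ℝ} (hR : 0 < R) {x : E3} (hx : x ∈ sphere (0 : E3) R) :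
    ∃ ξ ∈ sphere (0 : E3) 1, x = R • ξ := by
  refine ⟨R⁻¹ • x, ?_, ?_⟩
  · rw [mem_sphere_zero_iff_norm, norm_smul, mem_sphere_zero_iff_norm.1 hx, Real.norm_eq_abs,
      abs_of_pos (inv_pos.2 hR), inv_mul_cancel₀ hR.ne']
  · rw [smul_smul, mul_inv_cancel₀ hR.ne', one_smul]

end MaxwellBall

theorem proposition3p1 (R : ℝ) (hR : 0 < R) (k : ℂ) (hk : k ≠ 0) (n : ℕ) (hn : 1 ≤ n)
    (Y : MaxwellBall.E3 → ℂ) (hY : MaxwellBall.IsSphericalHarmonic n Y)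
    (hY0 : ∃ ξ ∈ Metric.sphere (0 : MaxwellBall.E3) 1, Y ξ ≠ 0) :
    MaxwellBall.IsDipoleEigenfunction R k (MaxwellBall.m1 n k R) (MaxwellBall.sphereCurl Y) ∧
    MaxwellBall.IsDipoleEigenfunction R k (MaxwellBall.m2 n k R) (MaxwellBall.sphereGrad Y) := by
  open MaxwellBall in
  obtain ⟨p, hp1, hp2, hYp⟩ := hY
  have hp : IsHarm n p := ⟨hp1, hp2⟩
  obtain ⟨ξ₀, hξ₀, hne⟩ := hY0
  rw [hYp ξ₀ hξ₀] at hne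
  have hC (η : S2) := sphereCurl_eq hp hYp hR η.2
  have hG (η : S2) := sphereGrad_eq hp hYp hR η.2
  refine ⟨⟨memTHdiv_cross hR _ _ hC (curlField_cross p), fun h0 => hne ?_, fun x hx => ?_⟩,
    ⟨memTHdiv_cross hR _ _ hG (gradField_cross hp), fun h0 => hne ?_, fun x hx => ?_⟩⟩
  · refine ev_eq_zero_of_rot_eq_zero hn hp (fun j η hη => ?_) hξ₀
    have := congrFun (vev_eq_zero hR hC h0 ⟨η, hη⟩) j
    simpa [vev, curlField] using this
  · obtain ⟨ξ, hξ, rfl⟩ := exists_smul_eq hR hx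
    exact dipole_of_polynomial hR k _ hξ (curlField p) (ev_cdot_curlField p ξ) _ hC
      fun j => curlField_eigen hn hp hR.ne' hk hξ j
  · refine ev_eq_zero_of_rot_eq_zero hn hp (fun j η hη => ?_) hξ₀
    have h1 := vev_eq_zero hR hG h0 ⟨η, hη⟩
    have h2 (i : Fin 3) : ev (gradField n p i) η = 0 := congrFun h1 i
    rw [← ev_ccross_gradField n p hη j, ev_ccross, h2, h2]
    ring
  · obtain ⟨ξ, hξ, rfl⟩ := exists_smul_eq hR hx
    exact dipole_of_polynomial hR k _ hξ (gradField n p) (ev_cdot_gradField hp hξ) _ hG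
      fun j => gradField_eigen hn hp hR.ne' hk hξ j
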